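/- Let $\phi_C(t)=\frac{1}{\cosh t}$, $\phi_S(t)=\frac{t}{\sinh t}$ and $\phi_T(t)=\frac{\tanh t}{t}$ for $t\in\mathbb R$; here and below $\frac{t}{\sinh t}$, $\frac{\tanh t}{t}$ and $t\coth t$ take the value $1$ at $t=0$. These are selfdecomposable characteristic functions: each is a characteristic function $\phi$ such that for every $0<c<1$ there is a characteristic function $\rho_c$ with $\phi(t)=\phi(ct)\rho_c(t)$ for all $t\in\mathbb R$. A characteristic function $\psi$ is called a background driving characteristic function of $\phi$ if there is a real-valued Lévy process $(Y(s))_{s\ge 0}$ (a process with $Y(0)=0$ a.s., with independent and stationary increments, continuous in probability) such that $Y(1)$ has characteristic function $\psi$ and the random integral $\int_0^\infty e^{-s}\,dY(s)$ exists and has characteristic function $\phi$. Here $\int_0^T e^{-s}\,dY(s)$ is the limit in probability of Riemann–Stieltjes sums, and $\int_0^\infty e^{-s}\,dY(s)$ is its limit in probability as $T\to\infty$. (i) Background driving characteristic functions of $\phi_C$, $\phi_S$, $\phi_T$ are, respectively, $$\psi_C(t)=\exp[-t\tanh t],\qquad \psi_S(t)=\exp[1-t\coth t],$$ $$\psi_T(t)=\exp\Big[\frac{1}{\cosh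 t}\cdot\frac{t}{\sinh t}-1\Big]=\exp\Big[\frac{2t}{\sinh 2t}-1\Big].$$ In each case $\log\phi$ is differentiable at every $t\neq0$ and $\psi(t)=\exp[t(\log\phi)'(t)]$ for $t\ne 0$. Moreover $\psi_C(t)=\psi_S(t)\psi_T(t)$ for all $t$, that is, $$\exp[-t\tanh t]=\exp[1-t\coth t]\cdot\exp\Big[\frac{t}{\cosh t\,\sinh t}-1\Big].$$ (ii) The probability distributions with characteristic functions $\psi_C$, $\psi_S$, $\psi_T$ are infinitely divisible and have finite logarithmic moments, $\int_{\mathbb R}\log(1+|x|)\,d\mu(x)<\infty$. (iii) The Lévy measures in the Lévy–Khintchine formulas of $\psi_C,\psi_S,\psi_T$ are the measures $N_C,N_S,N_T$ with densities $$\frac{dN_C(x)}{dx}=\frac{\pi}{4}\,\frac{\cosh(\pi x/2)}{\sinh^2(\pi x/2)},\qquad \frac{dN_S(x)}{dx}=\frac{\pi}{4}\,\frac{1}{\sinh^2(\pi x/2)},\qquad \frac{dN_T(x)}{dx}=\frac{\pi}{8}\,\frac{1}{\cosh^2(\pi x/4)},$$ and $N_C=N_S+N_T$. (iv) For all $t\in\mathbb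 R$ the following integrals converge absolutely and $$\int_{\mathbb R\setminus\{0\}}(1-\cos tx)\,\frac{\pi}{4}\,\frac{\cosh(\pi x/2)}{\sinh^2(\pi x/2)}\,dx=t\tanh t,\qquad \int_{\mathbb R\setminus\{0\}}(1-\cos tx)\,\frac{\pi}{4}\,\frac{1}{\sinh^2(\pi x/2)}\,dx=t\coth t-1,$$ $$\int_{\mathbb R\setminus\{0\}}(1-\cos tx)\,\frac{\pi}{8}\,\frac{1}{\cosh^2(\pi x/4)}\,dx=1-\frac{2t}{\sinh 2t},\qquad \int_{\mathbb R\setminus\{0\}}\cos(tx)\,\frac{\pi}{8}\,\frac{1}{\cosh^2(\pi x/4)}\,dx=\frac{2t}{\sinh 2t}.$$ -/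

import Mathlib

open MeasureTheory ProbabilityTheory Filter Topology
open scoped NNReal ENNReal

noncomputable section

namespace HyperbolicSD

/-! ### Classes of characteristic functions on the real line -/

/-- `φ` is the characteristic function of the probability measure `μ` on `ℝ`. -/
def HasCharFun (μ : Measure ℝ) (φ : ℝ → ℂ) : Prop :=
  IsProbabilityMeasure μ ∧ ∀ t : ℝ, charFun μ t = φ t

/-- `φ` is a characteristic function. -/
def IsCharFun (φ : ℝ → ℂ) : Prop :=
  ∃ μ : Measure ℝ, HasCharFun μ φ

/-- Selfdecomposable characteristic functions (the class SD): for every `0 < c < 1` one has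
`φ(t) = φ(ct) ρ_c(t)` for some characteristic function `ρ_c`. -/
def IsSelfdecomposable (φ : ℝ → ℂ) : Prop :=
  IsCharFun φ ∧ ∀ c : ℝ, 0 < c → c < 1 →
    ∃ ρ : ℝ → ℂ, IsCharFun ρ ∧ ∀ t : ℝ, φ t = φ (c * t) * ρ t

/-- Infinitely divisible characteristic functions (the class ID): for every `n ≥ 1`, `φ` is the
`n`-th power of a characteristic function. -/
def IsInfinitelyDivisible (φ : ℝ → ℂ) : Prop :=
  IsCharFun φ ∧ ∀ n : ℕ, 1 ≤ n → ∃ ρ : ℝ → ℂ, IsCharFun ρ ∧ ∀ t : ℝ, φ t = ρ t ^ n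

/-- The law `μ` has a finite logarithmic moment: `∫ log (1 + |x|) dμ(x) < ∞`. -/
def HasFiniteLogMoment (μ : Measure ℝ) : Prop :=
  Integrable (fun x : ℝ => Real.log (1 + |x|)) μ

/-! ### Lévy-Khintchine formula -/

/-- A Lévy (spectral) measure on `ℝ`: no mass at `0` and `∫ min(1, x²) dN(x) < ∞`. -/
def IsLevyMeasure (N : Measure ℝ) : Prop :=
  N {0} = 0 ∧ ∫⁻ x : ℝ, ENNReal.ofReal (min 1 (x ^ 2)) ∂N < ∞

/-- `N` is the Lévy spectral measure in the Lévy-Khintchine formula of `ψ`: for some `a : ℝ`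
and `v ≥ 0`, `ψ(t) = exp (i a t - v t² / 2 + ∫ (e^{itx} - 1 - i t x / (1 + x²)) dN(x))`. -/
def IsLevyMeasureOf (N : Measure ℝ) (ψ : ℝ → ℂ) : Prop :=
  IsLevyMeasure N ∧ ∃ a v : ℝ, 0 ≤ v ∧ ∀ t : ℝ,
    ψ t = Complex.exp (Complex.I * a * t - v * t ^ 2 / 2 +
      ∫ x : ℝ, (Complex.exp (Complex.I * t * x) - 1 - Complex.I * t * x / (1 + x ^ 2)) ∂N)

/-! ### Lévy processes and the random integral -/

/-- Real-valued Lévy process `(Y(s), s ≥ 0)`: `Y(0) = 0` almost surely, independent and stationary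
increments, continuity in probability. -/
structure IsLevyProcess {Ω : Type} [MeasurableSpace Ω] (P : Measure Ω) (Y : ℝ≥0 → Ω → ℝ) :
    Prop where
  measurable : ∀ s, Measurable (Y s)
  zero : ∀ᵐ ω ∂P, Y 0 ω = 0
  indep_increments : HasIndepIncrements Y P
  stationary_increments : ∀ s h : ℝ≥0, IdentDistrib (fun ω => Y (s + h) ω - Y s ω) (Y h) P P
  continuous_in_probability : ∀ s : ℝ≥0, TendstoInMeasure P Y (𝓝 s) (Y s)

/-- A tagged partition `0 = s₀ ≤ s₁ ≤ … ≤ s_n = T` of `[0, T]`, with tags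
`τ_i ∈ [s_i, s_{i+1}]`. Values of the sequences beyond the index `n` play no role. -/
structure TaggedPartition (T : ℝ≥0) where
  n : ℕ
  point : ℕ → ℝ≥0
  tag : ℕ → ℝ≥0
  point_zero : point 0 = 0
  point_n : point n = T
  point_le_tag : ∀ i < n, point i ≤ tag i
  tag_le_point : ∀ i < n, tag i ≤ point (i + 1)

/-- All intervals of the partition have length at most `δ`. -/
def TaggedPartition.MeshLE {T : ℝ≥0} (π : TaggedPartition T) (δ : ℝ) : Prop :=
  ∀ i < π.n, (π.point (i + 1) : ℝ) - π.point i ≤ δ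

/-- Riemann-Stieltjes sum `∑ f(τ_i) (Y(s_{i+1}) - Y(s_i))`. -/
def TaggedPartition.riemannSum {T : ℝ≥0} (π : TaggedPartition T) {Ω : Type}
    (f : ℝ → ℝ) (Y : ℝ≥0 → Ω → ℝ) (ω : Ω) : ℝ :=
  ∑ i ∈ Finset.range π.n, f (π.tag i) * (Y (π.point (i + 1)) ω - Y (π.point i) ω)

/-- The random variable `Z` is the random integral `∫_0^T f(s) dY(s)`: the Riemann-Stieltjes sums
converge to `Z` in probability as the mesh of the partition tends to `0`. -/
def IsRandomIntegral {Ω : Type} [MeasurableSpace Ω] (P : Measure Ω) (f : ℝ → ℝ)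
    (Y : ℝ≥0 → Ω → ℝ) (T : ℝ≥0) (Z : Ω → ℝ) : Prop :=
  Measurable Z ∧ ∀ ε : ℝ, 0 < ε → ∀ η : ℝ≥0∞, 0 < η → ∃ δ : ℝ, 0 < δ ∧
    ∀ π : TaggedPartition T, π.MeshLE δ → P {ω | ε ≤ |π.riemannSum f Y ω - Z ω|} ≤ η

/-- The random variable `X` is the random integral `∫_0^∞ f(s) dY(s)`: the limit in probability of
`∫_0^T f(s) dY(s)` as `T → ∞`. -/
def IsImproperRandomIntegral {Ω : Type} [MeasurableSpace Ω] (P : Measure Ω) (f : ℝ → ℝ)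
    (Y : ℝ≥0 → Ω → ℝ) (X : Ω → ℝ) : Prop :=
  Measurable X ∧ ∃ Z : ℝ≥0 → Ω → ℝ, (∀ T, IsRandomIntegral P f Y T (Z T)) ∧
    TendstoInMeasure P Z atTop X

/-- `ψ` is the background driving characteristic function of `φ`: there is a Lévy process `Y`
(the background driving Lévy process) such that `∫_0^∞ e^{-s} dY(s)` has characteristic function
`φ` and `Y(1)` has characteristic function `ψ`. -/
def IsBackgroundDrivingCharFun (ψ φ : ℝ → ℂ) : Prop :=
  ∃ (Ω : Type) (_ : MeasurableSpace Ω) (P : Measure Ω) (Y : ℝ≥0 → Ω → ℝ) (X : Ω → ℝ),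
    IsProbabilityMeasure P ∧ IsLevyProcess P Y ∧
    IsImproperRandomIntegral P (fun s => Real.exp (-s)) Y X ∧
    HasCharFun (P.map X) φ ∧ HasCharFun (P.map (Y 1)) ψ

/-! ### The hyperbolic functions, extended by continuity to `t = 0` -/

/-- `t / sinh t`, with value `1` at `t = 0`. -/
def divSinh (t : ℝ) : ℝ := if t = 0 then 1 else t / Real.sinh t

/-- `t coth t`, with value `1` at `t = 0`. -/
def mulCoth (t : ℝ) : ℝ := if t = 0 then 1 else t * (Real.cosh t / Real.sinh t)

/-- `φ_C(t) = 1 / cosh t`. -/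
def phiC (t : ℝ) : ℝ := 1 / Real.cosh t

/-- `φ_S(t) = t / sinh t`. -/
def phiS (t : ℝ) : ℝ := divSinh t

/-- `φ_T(t) = tanh t / t`, with value `1` at `t = 0`. -/
def phiT (t : ℝ) : ℝ := if t = 0 then 1 else Real.tanh t / t

/-- `ψ_C(t) = exp (-t tanh t)`. -/
def psiC (t : ℝ) : ℝ := Real.exp (-(t * Real.tanh t))

/-- `ψ_S(t) = exp (1 - t coth t)`. -/
def psiS (t : ℝ) : ℝ := Real.exp (1 - mulCoth t)

/-- `ψ_T(t) = exp (2t / sinh 2t - 1)`. -/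
def psiT (t : ℝ) : ℝ := Real.exp (divSinh (2 * t) - 1)

/-! ### The Lévy measures of the background driving laws -/

/-- Density of `N_C`. -/
def densC (x : ℝ) : ℝ :=
  Real.pi / 4 * (Real.cosh (Real.pi * x / 2) / Real.sinh (Real.pi * x / 2) ^ 2)

/-- Density of `N_S`. -/
def densS (x : ℝ) : ℝ := Real.pi / 4 * (1 / Real.sinh (Real.pi * x / 2) ^ 2)

/-- Density of `N_T`. -/
def densT (x : ℝ) : ℝ := Real.pi / 8 * (1 / Real.cosh (Real.pi * x / 4) ^ 2)

/-- The measure with density `h` with respect to Lebesgue measure. -/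
def measureOfDensity (h : ℝ → ℝ) : Measure ℝ :=
  volume.withDensity (fun x => ENNReal.ofReal (h x))

end HyperbolicSD

end

noncomputable section

namespace HyperbolicSD

/-! ### Kolmogorov extension for real-valued families -/

section Kolmogorov

variable {ι : Type*} {P : ∀ J : Finset ι, Measure (J → ℝ)}

/-! Write `φ = exp L` and `ψ = exp g` with `L`, `g` real and `g(t) = t L'(t)` for `t ≠ 0`. The core
is the representation `-g(t) = ∫ (1 - cos tx) h(x) dx` with an even density `h ≥ 0` such that `x² h`
is integrable; existence, infinite divisibility, Lévy measure, moments and the process are derived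
from it for general `h` (`IsLevyDensity`, `IsDrivingExponent`).

From `h` to the laws: truncating `h` near `0` gives compound Poisson laws, and Lévy's continuity
theorem yields a law with characteristic function `exp(s g)` for every `s ≥ 0`. Kolmogorov's
extension theorem then gives a process `Y` with `E exp(i ∑ c_s Y_s) = exp ∫ g(∑ c_s 1_{(0,s]}(r))
dr` (`HasExponent`), a formula that contains independence and stationarity of the increments.

Random integral: the bound `-g(u) ≤ K u²/2` makes `∑ c_s 1_{(0,s]} ↦ ∑ c_s Y_s` Lipschitz from
`L²(dr)` to `L²(P)`, so it extends to `e^{-r}` on `(0,T]` and on `(0,∞)`. Since `d/ds L(e^{-s}u) =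
-g(e^{-s}u)`, the integral over `(0,T]` has characteristic function `exp(L(u) - L(e^{-T}u))`.
Letting `T → ∞` gives `φ`; taking `e^{-T} = c` gives the factor `ρ_c` of selfdecomposability.

Explicit densities: on `x > 0` the density of `N_S` is `∑ πn e^{-πnx}`, and termwise integration
gives the partial fractions of `t coth t - 1`. The case `C` follows by dilation from `t tanh t = 2t
coth 2t - t coth t`, and the case `T` by subtraction. -/

/-- A sequence of cylinders with compact bases, all of whose finite intersections are nonempty,
has a nonempty intersection. -/
theorem nonempty_iInter_cylinder_of_isCompact (s : ℕ → Finset ι) (K : ∀ n, Set (s n → ℝ))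
    (hK : ∀ n, IsCompact (K n))
    (h : ∀ n, ∃ x : ι → ℝ, ∀ k ≤ n, x ∈ cylinder (α := fun _ => ℝ) (s k) (K k)) :
    (⋂ n, cylinder (α := fun _ => ℝ) (s n) (K n)).Nonempty := by
  choose x hx using h
  -- Limits along one free ultrafilter exist in all the compact bases at once; this replaces a
  -- diagonal extraction of subsequences.
  let U : Ultrafilter ℕ := hyperfilter ℕ
  have hU : ∀ k, ∀ᶠ n in (U : Filter ℕ), k ≤ n := fun k =>
    (Nat.hyperfilter_le_atTop : (U : Filter ℕ) ≤ atTop) (eventually_ge_atTop k)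
  have key : ∀ k, ∃ y ∈ K k, Tendsto (fun n => (s k).restrict (x n)) U (𝓝 y) := by
    intro k
    have := (hK k).ultrafilter_le_nhds (U.map fun n => (s k).restrict (x n)) (by
      rw [le_principal_iff, Ultrafilter.coe_map, mem_map]
      filter_upwards [hU k] with n hn using hx n k hn)
    exact this
  choose y hyK hy using key
  have hlim : ∀ i, ∃ a : ℝ, (∃ k, i ∈ s k) → Tendsto (fun n => x n i) U (𝓝 a) := by
    intro i
    by_cases hi : ∃ k, i ∈ s k
    · obtain ⟨k, hk⟩ := hi
      exact ⟨y k ⟨i, hk⟩, fun _ => (tendsto_pi_nhds.1 (hy k)) ⟨i, hk⟩⟩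
    · exact ⟨0, fun h => absurd h hi⟩
  choose a ha using hlim
  refine ⟨a, Set.mem_iInter.2 fun k => ?_⟩
  have : (s k).restrict a = y k := by
    ext i
    exact tendsto_nhds_unique (ha i ⟨k, i.2⟩) ((tendsto_pi_nhds.1 (hy k)) i)
  rw [mem_cylinder, this]
  exact hyK k

/-- If the contents stayed above `ε`, inner regularity would replace each base by a compact one,
with losses summing to less than `ε`. No finite intersection of the compact cylinders would then be
empty, so neither would the whole intersection. -/
theorem projectiveFamilyContent_tendsto_zero [∀ J, IsFiniteMeasure (P J)]
    (hP : IsProjectiveMeasureFamily (α := fun _ : ι => ℝ) P) {A : ℕ → Set (ι → ℝ)}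
    (A_mem : ∀ n, A n ∈ measurableCylinders (fun _ : ι => ℝ))
    (A_anti : Antitone A) (A_inter : ⋂ n, A n = ∅) :
    Tendsto (fun n => projectiveFamilyContent hP (A n)) atTop (𝓝 0) := by
  have A_cyl n : ∃ s S, MeasurableSet S ∧ A n = cylinder s S :=
    (mem_measurableCylinders _).1 (A_mem n)
  choose s S mS A_eq using A_cyl
  rw [ENNReal.tendsto_atTop_zero]
  by_contra! hcon
  obtain ⟨ε, hε, hcon⟩ := hcon
  have hbig : ∀ n, ε < projectiveFamilyContent hP (A n) := by
    intro n
    obtain ⟨m, hm, h⟩ := hcon n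
    exact h.trans_le (projectiveFamilyContent_mono hP (A_mem m) (A_mem n) (A_anti hm))
  obtain ⟨ε', hε', hsum⟩ := ENNReal.exists_pos_sum_of_countable' hε.ne' ℕ
  have hcomp : ∀ n, ∃ K ⊆ S n, IsCompact K ∧ P (s n) (S n \ K) < ε' n := fun n =>
    (mS n).exists_isCompact_sdiff_lt (measure_ne_top _ _) (hε' n).ne'
  choose K hKS hK hKε using hcomp
  have hKm : ∀ n, MeasurableSet (K n) := fun n => (hK n).measurableSet
  have hcyl : ∀ n, cylinder (α := fun _ => ℝ) (s n) (K n) ∈ measurableCylinders (fun _ : ι => ℝ) := fun n =>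
    (mem_measurableCylinders _).2 ⟨_, _, hKm n, rfl⟩
  have hne : (⋂ n, cylinder (α := fun _ => ℝ) (s n) (K n)).Nonempty := by
    refine nonempty_iInter_cylinder_of_isCompact s K hK fun n => ?_
    by_contra! hemp
    have hsub : A n ⊆ ⋃ k ≤ n, (A k \ cylinder (α := fun _ => ℝ) (s k) (K k)) := by
      intro x hx
      obtain ⟨k, hk, hxk⟩ := hemp x
      exact Set.mem_iUnion₂.2 ⟨k, hk, A_anti hk hx, hxk⟩
    have hD : ∀ k, A k \ cylinder (α := fun _ => ℝ) (s k) (K k) ∈ measurableCylinders (fun _ : ι => ℝ) := fun k =>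
      sdiff_mem_measurableCylinders (A_mem k) (hcyl k)
    have hDle : ∀ k, projectiveFamilyContent hP (A k \ cylinder (α := fun _ => ℝ) (s k) (K k)) ≤ ε' k := by
      intro k
      have : A k \ cylinder (α := fun _ => ℝ) (s k) (K k) = cylinder (α := fun _ => ℝ) (s k) (S k \ K k) := by
        rw [A_eq k, sdiff_cylinder_same]
      rw [this, projectiveFamilyContent_cylinder hP ((mS k).diff (hKm k))]
      exact (hKε k).le
    have h1 : projectiveFamilyContent hP (A n) ≤ ∑ k ∈ Finset.range (n + 1), ε' k := by
      refine (projectiveFamilyContent_mono hP (A_mem n) ?_ hsub).trans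
        ((projectiveFamilyContent_iUnion_le hP hD n).trans (Finset.sum_le_sum fun k _ => hDle k))
      have : (⋃ k ≤ n, (A k \ cylinder (α := fun _ => ℝ) (s k) (K k))) =
          ⋃ k ∈ Finset.range (n + 1), (A k \ cylinder (α := fun _ => ℝ) (s k) (K k)) := by
        simp only [Finset.mem_range_succ_iff]
      rw [this]
      exact isSetRing_measurableCylinders.biUnion_mem _ fun k _ => hD k
    exact absurd (hbig n) (not_lt.2 (h1.trans ((ENNReal.sum_le_tsum _).trans hsum.le)))
  obtain ⟨x, hx⟩ := hne
  have : x ∈ ⋂ n, A n := by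
    refine Set.mem_iInter.2 fun n => ?_
    rw [A_eq n, mem_cylinder]
    exact hKS n ((mem_cylinder _ _ _).1 (Set.mem_iInter.1 hx n))
  simp [A_inter] at this

/-- **Kolmogorov's extension theorem** for real-valued projective families. -/
theorem exists_isProjectiveLimit_real [∀ J, IsFiniteMeasure (P J)]
    (hP : IsProjectiveMeasureFamily (α := fun _ : ι => ℝ) P) :
    ∃ Q : Measure (ι → ℝ), IsProjectiveLimit (α := fun _ : ι => ℝ) Q P := by
  have hσ : (projectiveFamilyContent hP).IsSigmaSubadditive := by
    refine isSigmaSubadditive_of_addContent_iUnion_eq_tsum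
      isSetRing_measurableCylinders (fun f hf hf_Union hf' => ?_)
    exact addContent_iUnion_eq_sum_of_tendsto_zero isSetRing_measurableCylinders
      (projectiveFamilyContent hP) (fun s hs => projectiveFamilyContent_ne_top _)
      (fun _ => projectiveFamilyContent_tendsto_zero hP) hf hf_Union hf'
  refine ⟨(projectiveFamilyContent hP).measure isSetSemiring_measurableCylinders
    generateFrom_measurableCylinders.ge hσ, fun I => ?_⟩
  ext s hs
  rw [Measure.map_apply (by fun_prop) hs, AddContent.measure_eq]
  · exact projectiveFamilyContent_cylinder hP hs
  · exact generateFrom_measurableCylinders.symm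
  · exact cylinder_mem_measurableCylinders _ _ hs

end Kolmogorov

/-! ### Processes with a given exponent -/

/-- Composition of a function vanishing at `0` with a finite combination of indicators of disjoint
sets. -/
theorem comp_sum_indicator {κ : Type*} (F : Finset κ) (A : κ → Set ℝ) (v : κ → ℝ)
    (hd : (F : Set κ).PairwiseDisjoint A) {g : ℝ → ℝ} (hg : g 0 = 0) (r : ℝ) :
    g (∑ k ∈ F, (A k).indicator (fun _ => v k) r) =
      ∑ k ∈ F, (A k).indicator (fun _ => g (v k)) r := by
  classical
  by_cases h : ∃ k ∈ F, r ∈ A k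
  · obtain ⟨k, hk, hr⟩ := h
    have hz : ∀ j ∈ F, j ≠ k → r ∉ A j := fun j hj hjk hrj =>
      Set.disjoint_left.1 (hd hj hk hjk) hrj hr
    rw [Finset.sum_eq_single_of_mem k hk fun j hj hjk => Set.indicator_of_notMem (hz j hj hjk) _,
      Finset.sum_eq_single_of_mem k hk fun j hj hjk => Set.indicator_of_notMem (hz j hj hjk) _,
      Set.indicator_of_mem hr, Set.indicator_of_mem hr]
  · push Not at h
    rw [Finset.sum_eq_zero fun j hj => Set.indicator_of_notMem (h j hj) _,
      Finset.sum_eq_zero fun j hj => Set.indicator_of_notMem (h j hj) _, hg]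

theorem integral_comp_sum_indicator {κ : Type*} (F : Finset κ) (A : κ → Set ℝ) (v : κ → ℝ)
    (hA : ∀ k ∈ F, MeasurableSet (A k)) (hfin : ∀ k ∈ F, volume (A k) ≠ ∞)
    (hd : (F : Set κ).PairwiseDisjoint A) {g : ℝ → ℝ} (hg : g 0 = 0) :
    ∫ r, g (∑ k ∈ F, (A k).indicator (fun _ => v k) r) =
      ∑ k ∈ F, volume.real (A k) * g (v k) := by
  simp_rw [comp_sum_indicator F A v hd hg]
  rw [integral_finsetSum]
  · refine Finset.sum_congr rfl fun k hk => ?_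
    rw [integral_indicator (hA k hk)]
    simp
  · intro k hk
    rw [integrable_indicator_iff (hA k hk)]
    exact integrableOn_const (hfin k hk)

/-! ### Finite-dimensional laws with independent increments. -/

section Marginals

variable (I : Finset ℝ≥0)

/-- The largest element of `I` below `s`, or `0`. -/
def predIn (s : I) : ℝ≥0 := (Finset.univ.filter fun r : I => r < s).sup fun r => (r : ℝ≥0)

variable {I}

theorem predIn_lt_iff {s : I} {x : ℝ} (hx : 0 < x) :
    (predIn I s : ℝ) < x ↔ ∀ r : I, r < s → ((r : ℝ≥0) : ℝ) < x := by
  lift x to ℝ≥0 using hx.le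
  rw [NNReal.coe_lt_coe, predIn, Finset.sup_lt_iff (by simpa using hx)]
  simp

theorem predIn_le (s : I) : predIn I s ≤ s :=
  Finset.sup_le fun r hr => by
    have := (Finset.mem_filter.1 hr).2
    exact this.le

/-- Each `x` in `(0, max I]` selects the least time of `I` not below it. Uniqueness of this minimum
makes the intervals disjoint, its existence makes them cover. -/
theorem mem_Ioc_predIn_iff {s : I} {x : ℝ} (hx : 0 < x) :
    x ∈ Set.Ioc (predIn I s : ℝ) (s : ℝ≥0) ↔
      IsLeast {r : I | x ≤ ((r : ℝ≥0) : ℝ)} s := by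
  rw [Set.mem_Ioc, predIn_lt_iff hx]
  refine ⟨fun h => ⟨h.2, fun r hr => ?_⟩, fun h => ⟨fun r hr => ?_, h.1⟩⟩
  · by_contra hlt
    exact absurd (h.1 r (not_le.1 hlt)) (not_lt.2 hr)
  · by_contra hle
    exact absurd (h.2 (not_lt.1 hle)) (not_le.2 hr)

theorem pairwiseDisjoint_Ioc_predIn :
    ((Finset.univ : Finset I) : Set I).PairwiseDisjoint
      fun s : I => Set.Ioc (predIn I s : ℝ) (s : ℝ≥0) := by
  intro s _ t _ hst
  refine Set.disjoint_left.2 fun x hs ht => hst ?_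
  have hx : 0 < x := lt_of_le_of_lt (NNReal.coe_nonneg _) hs.1
  exact ((mem_Ioc_predIn_iff hx).1 hs).unique ((mem_Ioc_predIn_iff hx).1 ht)

theorem sum_indicator_Ioc_predIn (s : I) (x : ℝ) :
    ∑ r : I with r ≤ s, (Set.Ioc (predIn I r : ℝ) (r : ℝ≥0)).indicator (1 : ℝ → ℝ) x =
      (Set.Ioc (0 : ℝ) (s : ℝ≥0)).indicator (1 : ℝ → ℝ) x := by
  by_cases hx : x ∈ Set.Ioc (0 : ℝ) (s : ℝ≥0)
  · have hne : (Finset.univ.filter fun r : I => x ≤ ((r : ℝ≥0) : ℝ)).Nonempty :=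
      ⟨s, by simpa using hx.2⟩
    obtain ⟨m, hm⟩ : ∃ m, IsLeast {r : I | x ≤ ((r : ℝ≥0) : ℝ)} m :=
      ⟨_, by simpa using Finset.isLeast_min' _ hne⟩
    rw [Set.indicator_of_mem hx, Finset.sum_eq_single_of_mem m
      (by simpa using hm.2 (show x ≤ ((s : ℝ≥0) : ℝ) from hx.2)),
      Set.indicator_of_mem ((mem_Ioc_predIn_iff hx.1).2 hm)]
    · intro r _ hr
      exact Set.indicator_of_notMem (fun h => hr (((mem_Ioc_predIn_iff hx.1).1 h).unique hm)) _
  · rw [Set.indicator_of_notMem hx]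
    refine Finset.sum_eq_zero fun r hr => Set.indicator_of_notMem (fun h => hx ?_) _
    have hrs : r ≤ s := by simpa using hr
    exact ⟨lt_of_le_of_lt (NNReal.coe_nonneg _) h.1,
      h.2.trans (NNReal.coe_le_coe.2 hrs)⟩

variable (μ : ℝ≥0 → Measure ℝ) (I)

/-- Law of the values at the times in `I` of a process with independent increments, whose
increments over intervals of length `s` have law `μ s`. -/
def marginalLaw : Measure (I → ℝ) :=
  (Measure.pi fun s : I => μ (s - predIn I s)).map fun ξ s => ∑ r : I with r ≤ s, ξ r

variable [∀ s, IsProbabilityMeasure (μ s)]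

instance : IsProbabilityMeasure (marginalLaw I μ) :=
  Measure.isProbabilityMeasure_map (by fun_prop)

variable {μ} {g : ℝ → ℝ}

/-- Summation by parts rewrites `∑ u_s x_s` in the independent increments `ξ_r`, with coefficients
`v_r = ∑_{s ≥ r} u_s`; these are also the values of `∑ u_s 1_{(0,s]}` on the intervals between
consecutive times. The right side sees `I` only through this step function, which is what makes the
family consistent. -/
theorem integral_exp_marginalLaw (hg : g 0 = 0)
    (hμ : ∀ s u, charFun (μ s) u = Complex.exp ((s * g u : ℝ) : ℂ)) (u : I → ℝ) :
    ∫ x, Complex.exp ((∑ s, u s * x s : ℝ) * Complex.I) ∂(marginalLaw I μ) =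
      Complex.exp ((∫ r, g (∑ s, u s * (Set.Ioc (0 : ℝ) (s : ℝ≥0)).indicator 1 r) : ℝ) : ℂ) := by
  set v : I → ℝ := fun r => ∑ s : I with r ≤ s, u s
  have hswap : ∀ ξ : I → ℝ, ∑ s, u s * ∑ r : I with r ≤ s, ξ r = ∑ r, v r * ξ r := by
    intro ξ
    simp only [v, Finset.mul_sum, Finset.sum_mul, Finset.sum_filter, mul_ite, ite_mul, mul_zero,
      zero_mul]
    rw [Finset.sum_comm]
  rw [marginalLaw, integral_map (by fun_prop) (Continuous.aestronglyMeasurable (by fun_prop))]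
  simp_rw [hswap]
  have hprod : ∀ ξ : I → ℝ, Complex.exp ((∑ r, v r * ξ r : ℝ) * Complex.I) =
      ∏ r, Complex.exp (v r * ξ r * Complex.I) := by
    intro ξ
    rw [← Complex.exp_sum]
    push_cast
    rw [Finset.sum_mul]
  simp_rw [hprod]
  rw [integral_fintype_prod_eq_prod (𝕜 := ℂ)
    (f := fun (r : I) (x : ℝ) => Complex.exp (v r * x * Complex.I))]
  simp_rw [← charFun_apply_real, hμ]
  rw [← Complex.exp_sum, ← Complex.ofReal_sum]
  congr 2
  -- This is `hswap` again, with the indicators of the elementary intervals in the role of the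
  -- increments.
  have hpt : ∀ r : ℝ, ∑ s, u s * (Set.Ioc (0 : ℝ) (s : ℝ≥0)).indicator (1 : ℝ → ℝ) r =
      ∑ s : I, (Set.Ioc (predIn I s : ℝ) (s : ℝ≥0)).indicator (fun _ => v s) r := by
    intro r
    have := hswap fun s => (Set.Ioc (predIn I s : ℝ) (s : ℝ≥0)).indicator (1 : ℝ → ℝ) r
    simp_rw [sum_indicator_Ioc_predIn] at this
    rw [this]
    refine Finset.sum_congr rfl fun s _ => ?_
    by_cases h : r ∈ Set.Ioc (predIn I s : ℝ) (s : ℝ≥0) <;> simp [h]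
  simp_rw [hpt]
  rw [integral_comp_sum_indicator _ _ _ (fun _ _ => measurableSet_Ioc) (fun _ _ => by simp)
    pairwiseDisjoint_Ioc_predIn hg]
  refine Finset.sum_congr rfl fun s _ => ?_
  rw [NNReal.coe_sub (predIn_le s), Real.volume_real_Ioc_of_le (NNReal.coe_le_coe.2 (predIn_le s))]

theorem isProjectiveMeasureFamily_marginalLaw (hg : g 0 = 0)
    (hμ : ∀ s u, charFun (μ s) u = Complex.exp ((s * g u : ℝ) : ℂ)) :
    IsProjectiveMeasureFamily (α := fun _ : ℝ≥0 => ℝ) fun I => marginalLaw I μ := by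
  classical
  intro J I hIJ
  have : IsProbabilityMeasure ((marginalLaw J μ).map
      (Finset.restrict₂ (π := fun _ : ℝ≥0 => ℝ) hIJ)) :=
    Measure.isProbabilityMeasure_map (Finset.measurable_restrict₂ _).aemeasurable
  change marginalLaw I μ = (marginalLaw J μ).map (Finset.restrict₂ (π := fun _ : ℝ≥0 => ℝ) hIJ)
  refine Measure.ext_of_charFunDual ?_
  ext L
  have hL : ∀ x : I → ℝ, L x = ∑ s, L (Pi.single s 1) * x s := by
    intro x
    conv_lhs => rw [pi_eq_sum_univ' x, map_sum]
    refine Finset.sum_congr rfl fun s _ => ?_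
    rw [map_smul, smul_eq_mul, mul_comm]
  -- Extending the coefficients by `0` from `I` to `J` leaves the step function unchanged.
  set u : J → ℝ := fun s => if h : (s : ℝ≥0) ∈ I then L (Pi.single ⟨s, h⟩ 1) else 0
  have hsum : ∀ y : J → ℝ, ∑ s : I, L (Pi.single s 1) * y ⟨s, hIJ s.2⟩ = ∑ s, u s * y s := by
    intro y
    refine Fintype.sum_of_injective (fun s : I => (⟨s, hIJ s.2⟩ : J)) ?_ _ _ ?_ ?_
    · exact fun a b hab => Subtype.ext (congrArg (fun z : J => (z : ℝ≥0)) hab)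
    · intro s hs
      have : (s : ℝ≥0) ∉ I := fun h => hs ⟨⟨s, h⟩, rfl⟩
      rw [show u s = 0 from dif_neg this, zero_mul]
    · intro s
      have : u ⟨s, hIJ s.2⟩ = L (Pi.single s 1) := dif_pos s.2
      rw [this]
  have hI : ∫ x, Complex.exp (L x * Complex.I) ∂(marginalLaw I μ) =
      ∫ x, Complex.exp ((∑ s, L (Pi.single s 1) * x s : ℝ) * Complex.I) ∂(marginalLaw I μ) := by
    congr 1
    ext x
    rw [hL x]
  have hJ : ∀ x : J → ℝ, L (Finset.restrict₂ (π := fun _ : ℝ≥0 => ℝ) hIJ x) = ∑ s, u s * x s :=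
    fun x => (hL _).trans (hsum x)
  have hmap : ∫ x, Complex.exp (L x * Complex.I) ∂((marginalLaw J μ).map
        (Finset.restrict₂ (π := fun _ : ℝ≥0 => ℝ) hIJ)) =
      ∫ x, Complex.exp (L (Finset.restrict₂ (π := fun _ : ℝ≥0 => ℝ) hIJ x) * Complex.I)
        ∂(marginalLaw J μ) :=
    integral_map (Finset.measurable_restrict₂ _).aemeasurable
      (Continuous.aestronglyMeasurable (by fun_prop))
  rw [charFunDual_apply, charFunDual_apply, hmap, hI, integral_exp_marginalLaw I hg hμ]
  simp_rw [hJ]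
  rw [integral_exp_marginalLaw J hg hμ]
  congr 3
  ext r
  rw [← hsum fun s : J => (Set.Ioc (0 : ℝ) (s : ℝ≥0)).indicator 1 r]

end Marginals

/-- The step function `∑ c_s 1_{(0, s]}`. -/
def stepFun : (ℝ≥0 →₀ ℝ) →ₗ[ℝ] ℝ → ℝ :=
  Finsupp.linearCombination ℝ fun s : ℝ≥0 => (Set.Ioc (0 : ℝ) s).indicator (1 : ℝ → ℝ)

/-- The process `Y` has exponent `g`: every finite combination `∑ c_s Y_s` of its values has
`E exp (i ∑ c_s Y_s) = exp (∫ g (∑ c_s 1_{(0, s]}(r)) dr)`. -/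
structure HasExponent {Ω : Type*} [MeasurableSpace Ω] (P : Measure Ω) (Y : ℝ≥0 → Ω → ℝ)
    (g : ℝ → ℝ) : Prop where
  measurable : ∀ s, Measurable (Y s)
  integral_exp : ∀ c : ℝ≥0 →₀ ℝ,
    ∫ ω, Complex.exp ((Finsupp.linearCombination ℝ Y c ω : ℝ) * Complex.I) ∂P =
      Complex.exp ((∫ r, g (stepFun c r) : ℝ) : ℂ)

/-- Existence of the process with exponent `g`. -/
theorem exists_hasExponent {g : ℝ → ℝ} (hg : g 0 = 0) (μ : ℝ≥0 → Measure ℝ)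
    [∀ s, IsProbabilityMeasure (μ s)]
    (hμ : ∀ s u, charFun (μ s) u = Complex.exp ((s * g u : ℝ) : ℂ)) :
    ∃ P : Measure (ℝ≥0 → ℝ), IsProbabilityMeasure P ∧ HasExponent P (fun s ω => ω s) g := by
  obtain ⟨P, hP⟩ := exists_isProjectiveLimit_real (isProjectiveMeasureFamily_marginalLaw hg hμ)
  refine ⟨P, hP.isProbabilityMeasure, fun s => measurable_pi_apply s, fun c => ?_⟩
  have h := integral_exp_marginalLaw c.support hg hμ fun s => c s
  have hc : P.map c.support.restrict = marginalLaw c.support μ := hP c.support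
  rw [← hc, integral_map (by fun_prop) (Continuous.aestronglyMeasurable (by fun_prop))] at h
  have e1 : ∀ ω : ℝ≥0 → ℝ, Finsupp.linearCombination ℝ (fun s (ω : ℝ≥0 → ℝ) => ω s) c ω =
      ∑ s : c.support, c s * c.support.restrict ω s := by
    intro ω
    rw [Finsupp.linearCombination_apply, Finsupp.sum, Finset.sum_apply]
    exact (Finset.sum_coe_sort c.support fun s => c s * ω s).symm
  have e2 : ∀ r : ℝ, stepFun c r =
      ∑ s : c.support, c s * (Set.Ioc (0 : ℝ) (s : ℝ≥0)).indicator 1 r := by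
    intro r
    rw [stepFun, Finsupp.linearCombination_apply, Finsupp.sum, Finset.sum_apply]
    exact (Finset.sum_coe_sort c.support
      fun s => c s * (Set.Ioc (0 : ℝ) s).indicator 1 r).symm
  simp_rw [e1, e2]
  exact h

/-! ### Second moments from characteristic functions -/

theorem tendsto_two_mul_one_sub_cos_div_sq (x : ℝ) :
    Tendsto (fun u : ℝ => 2 * (1 - Real.cos (u * x)) / u ^ 2) (𝓝[≠] 0) (𝓝 (x ^ 2)) := by
  have h1 : Tendsto (fun u : ℝ => Real.sinc (u * x / 2)) (𝓝[≠] 0) (𝓝 1) := by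
    have : Continuous fun u : ℝ => Real.sinc (u * x / 2) := by fun_prop
    simpa using (this.tendsto 0).mono_left nhdsWithin_le_nhds
  have h2 := (h1.pow 2).const_mul (x ^ 2)
  rw [one_pow, mul_one] at h2
  refine h2.congr' ?_
  filter_upwards [self_mem_nhdsWithin] with u hu
  have hu : u ≠ 0 := hu
  have hs := Real.sin_sq_eq_half_sub (u * x / 2)
  rw [show 2 * (u * x / 2) = u * x by ring] at hs
  rcases eq_or_ne x 0 with rfl | hx
  · simp
  · rw [Real.sinc_of_ne_zero (by positivity), div_pow, hs]
    field_simp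

/-- Fatou's lemma for `2(1 - cos ux)/u² → x²` along `u = 1/(n+1)`: the hypothesis bounds every
integral in the sequence by `K`. -/
theorem lintegral_sq_le_of_charFun {ν : Measure ℝ} [IsProbabilityMeasure ν] {K : ℝ}
    (h : ∀ u : ℝ, 1 - (charFun ν u).re ≤ K * u ^ 2 / 2) :
    ∫⁻ x, ENNReal.ofReal (x ^ 2) ∂ν ≤ ENNReal.ofReal K := by
  set u : ℕ → ℝ := fun n => 1 / ((n : ℝ) + 1)
  have hupos : ∀ n, 0 < u n := fun n => by positivity
  have hu : Tendsto u atTop (𝓝[≠] 0) :=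
    tendsto_nhdsWithin_iff.2 ⟨tendsto_one_div_add_atTop_nhds_zero_nat,
      Eventually.of_forall fun n => (hupos n).ne'⟩
  have hint : ∀ v : ℝ, Integrable (fun x => 1 - Real.cos (v * x)) ν := fun v => by
    refine Integrable.of_bound (C := 2) (by fun_prop) (ae_of_all _ fun x => ?_)
    rw [Real.norm_eq_abs, abs_le]
    constructor <;> linarith [Real.neg_one_le_cos (v * x), Real.cos_le_one (v * x)]
  have hre : ∀ v : ℝ, ∫ x, (1 - Real.cos (v * x)) ∂ν = 1 - (charFun ν v).re := by
    intro v
    have hi : Integrable (fun x : ℝ => Complex.exp (v * x * Complex.I)) ν := by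
      refine Integrable.of_bound (C := 1) (by fun_prop) (ae_of_all _ fun x => ?_)
      rw [← Complex.ofReal_mul, Complex.norm_exp_ofReal_mul_I]
    have hc : ∀ x : ℝ, Real.cos (v * x) = (Complex.exp (v * x * Complex.I)).re := fun x => by
      rw [← Complex.ofReal_mul, Complex.exp_ofReal_mul_I_re]
    simp_rw [hc]
    have hr : Integrable (fun x : ℝ => (Complex.exp (v * x * Complex.I)).re) ν := hi.re
    have hir : ∫ x : ℝ, (Complex.exp (v * x * Complex.I)).re ∂ν =
        (∫ x : ℝ, Complex.exp (v * x * Complex.I) ∂ν).re := integral_re hi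
    rw [integral_sub (integrable_const _) hr, charFun_apply_real, hir]
    simp
  have hle : ∀ n, ∫⁻ x, ENNReal.ofReal (2 * (1 - Real.cos (u n * x)) / u n ^ 2) ∂ν
      ≤ ENNReal.ofReal K := by
    intro n
    have he : ∀ x : ℝ, 2 * (1 - Real.cos (u n * x)) / u n ^ 2 =
        2 / u n ^ 2 * (1 - Real.cos (u n * x)) := fun x => by ring
    simp_rw [he]
    rw [← ofReal_integral_eq_lintegral_ofReal ((hint _).const_mul _)
      (ae_of_all _ fun x => mul_nonneg (by positivity) (by linarith [Real.cos_le_one (u n * x)])),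
      integral_const_mul, hre]
    refine ENNReal.ofReal_le_ofReal ?_
    have h1 := h (u n)
    have h2 : 0 < u n ^ 2 := by have := hupos n; positivity
    rw [div_mul_eq_mul_div, div_le_iff₀ h2]
    linarith
  have hlim : ∀ x : ℝ, liminf (fun n =>
      ENNReal.ofReal (2 * (1 - Real.cos (u n * x)) / u n ^ 2)) atTop = ENNReal.ofReal (x ^ 2) :=
    fun x => (ENNReal.tendsto_ofReal ((tendsto_two_mul_one_sub_cos_div_sq x).comp hu)).liminf_eq
  calc ∫⁻ x, ENNReal.ofReal (x ^ 2) ∂ν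
      = ∫⁻ x, liminf (fun n =>
          ENNReal.ofReal (2 * (1 - Real.cos (u n * x)) / u n ^ 2)) atTop ∂ν := by simp_rw [hlim]
    _ ≤ liminf (fun n =>
          ∫⁻ x, ENNReal.ofReal (2 * (1 - Real.cos (u n * x)) / u n ^ 2) ∂ν) atTop :=
        lintegral_liminf_le fun n => by fun_prop
    _ ≤ ENNReal.ofReal K := by
        refine (liminf_le_liminf (Eventually.of_forall hle)).trans ?_
        simp

/-! ### Lévy processes with exponent `g` -/

theorem stepFun_single (s : ℝ≥0) (a : ℝ) (r : ℝ) :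
    stepFun (Finsupp.single s a) r = (Set.Ioc (0 : ℝ) s).indicator (fun _ => a) r := by
  rw [stepFun, Finsupp.linearCombination_single]
  by_cases h : r ∈ Set.Ioc (0 : ℝ) s <;> simp [h]

/-- The coefficients of `∑ v_i (Y(t_{i+1}) - Y(t_i))`. -/
def incrementCoeff (t : ℕ → ℝ≥0) (v : ℕ → ℝ) (n : ℕ) : ℝ≥0 →₀ ℝ :=
  ∑ i ∈ Finset.range n, (Finsupp.single (t (i + 1)) (v i) - Finsupp.single (t i) (v i))

theorem linearCombination_incrementCoeff {Ω : Type*} (Y : ℝ≥0 → Ω → ℝ) (t : ℕ → ℝ≥0) (v : ℕ → ℝ)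
    (n : ℕ) (ω : Ω) : Finsupp.linearCombination ℝ Y (incrementCoeff t v n) ω =
      ∑ i ∈ Finset.range n, v i * (Y (t (i + 1)) ω - Y (t i) ω) := by
  simp [incrementCoeff, mul_sub]

theorem stepFun_incrementCoeff (t : ℕ → ℝ≥0) (v : ℕ → ℝ) (n : ℕ)
    (ht : ∀ i < n, t i ≤ t (i + 1)) (r : ℝ) :
    stepFun (incrementCoeff t v n) r =
      ∑ i ∈ Finset.range n, (Set.Ioc (t i : ℝ) (t (i + 1))).indicator (fun _ => v i) r := by
  rw [incrementCoeff, map_sum, Finset.sum_apply]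
  refine Finset.sum_congr rfl fun i hi => ?_
  have h1 : (t i : ℝ) ≤ t (i + 1) := NNReal.coe_le_coe.2 (ht i (Finset.mem_range.1 hi))
  have h0 : (0 : ℝ) ≤ t i := NNReal.coe_nonneg _
  rw [map_sub, Pi.sub_apply, stepFun_single, stepFun_single]
  simp only [Set.indicator_apply, Set.mem_Ioc]
  split_ifs <;> first | (exfalso; grind) | simp

theorem memLp_stepFun (c : ℝ≥0 →₀ ℝ) : MemLp (stepFun c) 2 volume := by
  rw [stepFun, Finsupp.linearCombination_apply, Finsupp.sum]
  refine memLp_finsetSum' _ fun s _ => MemLp.const_smul ?_ _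
  exact memLp_indicator_const 2 measurableSet_Ioc (1 : ℝ) (Or.inr (by simp))

namespace HasExponent

variable {Ω : Type} [MeasurableSpace Ω] {P : Measure Ω}
  {Y : ℝ≥0 → Ω → ℝ} {g : ℝ → ℝ}

theorem measurable_linearCombination (hY : HasExponent P Y g) (c : ℝ≥0 →₀ ℝ) :
    Measurable (Finsupp.linearCombination ℝ Y c) := by
  have : Finsupp.linearCombination ℝ Y c = fun ω => ∑ s ∈ c.support, (c s • Y s) ω := by
    ext ω
    rw [Finsupp.linearCombination_apply, Finsupp.sum, Finset.sum_apply]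
  rw [this]
  exact Finset.measurable_sum _ fun s _ => Measurable.const_smul (hY.measurable s) (c s)

theorem charFun_map (hY : HasExponent P Y g) (c : ℝ≥0 →₀ ℝ) (u : ℝ) :
    charFun (P.map (Finsupp.linearCombination ℝ Y c)) u =
      Complex.exp ((∫ r, g (u * stepFun c r) : ℝ) : ℂ) := by
  rw [charFun_apply_real, integral_map (hY.measurable_linearCombination c).aemeasurable
    (Continuous.aestronglyMeasurable (by fun_prop))]
  have := hY.integral_exp (u • c)
  simpa [map_smul] using this

/-- On disjoint intervals, and because `g 0 = 0`, the integral of `g` of a step function is a sum.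
So the joint characteristic function of the increments factorises, with factors depending only on
the lengths. -/
theorem integral_exp_increments (hY : HasExponent P Y g) (hg : g 0 = 0) {t : ℕ → ℝ≥0}
    (ht : Monotone t) (v : ℕ → ℝ) (n : ℕ) :
    ∫ ω, Complex.exp ((∑ i ∈ Finset.range n, v i * (Y (t (i + 1)) ω - Y (t i) ω) : ℝ) *
        Complex.I) ∂P =
      Complex.exp ((∑ i ∈ Finset.range n, ((t (i + 1) : ℝ) - t i) * g (v i) : ℝ) : ℂ) := by
  have h := hY.integral_exp (incrementCoeff t v n)
  simp_rw [linearCombination_incrementCoeff,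
    stepFun_incrementCoeff t v n fun i _ => ht (Nat.le_succ i)] at h
  rw [h, integral_comp_sum_indicator _ _ _ (fun _ _ => measurableSet_Ioc) (fun _ _ => by simp) _ hg]
  · congr 2
    refine Finset.sum_congr rfl fun i _ => ?_
    rw [Real.volume_real_Ioc_of_le (NNReal.coe_le_coe.2 (ht (Nat.le_succ i)))]
  · have hm : Monotone fun i => (t i : ℝ) := fun i j hij => NNReal.coe_le_coe.2 (ht hij)
    exact fun i _ j _ hij => hm.pairwise_disjoint_on_Ioc_succ hij

theorem charFun_map_sub (hY : HasExponent P Y g) (hg : g 0 = 0) {s t : ℝ≥0} (hst : s ≤ t)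
    (u : ℝ) : charFun (P.map fun ω => Y t ω - Y s ω) u =
      Complex.exp ((((t : ℝ) - s) * g u : ℝ) : ℂ) := by
  have := hY.integral_exp_increments hg (t := fun i => if i = 0 then s else t)
    (by intro i j hij; grind) (fun _ => u) 1
  have hm : Measurable fun ω => Y t ω - Y s ω := (hY.measurable t).sub (hY.measurable s)
  rw [charFun_apply_real, integral_map hm.aemeasurable
    (Continuous.aestronglyMeasurable (by fun_prop))]
  simpa using this

theorem charFun_map_apply (hY : HasExponent P Y g) (hg : g 0 = 0) (s : ℝ≥0) (u : ℝ) :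
    charFun (P.map (Y s)) u = Complex.exp ((s * g u : ℝ) : ℂ) := by
  have h := hY.charFun_map (Finsupp.single s 1) u
  have h2 := integral_comp_sum_indicator {()} (fun _ => Set.Ioc (0 : ℝ) s) (fun _ => u)
    (by simp) (by simp) (by simp) hg
  simp only [Finset.sum_singleton] at h2
  have e : ∀ r, u * stepFun (Finsupp.single s 1) r =
      (Set.Ioc (0 : ℝ) s).indicator (fun _ => u) r := fun r => by
    rw [stepFun_single]
    by_cases h : r ∈ Set.Ioc (0 : ℝ) s <;> simp [h]
  simp_rw [e] at h
  rw [h2, Real.volume_real_Ioc_of_le (NNReal.coe_nonneg s)] at h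
  simpa using h

theorem hasIndepIncrements [IsProbabilityMeasure P] (hY : HasExponent P Y g) (hg : g 0 = 0) :
    HasIndepIncrements Y P := by
  intro n t ht
  have hm : ∀ i : Fin n, Measurable fun ω => Y (t i.succ) ω - Y (t i.castSucc) ω :=
    fun i => (hY.measurable _).sub (hY.measurable _)
  rw [iIndepFun_iff_charFun_pi fun i => (hm i).aemeasurable]
  intro v
  -- The times are frozen after index `n`, to obtain a monotone sequence on all of `ℕ`.
  set t' : ℕ → ℝ≥0 := fun k => t ⟨min n k, by omega⟩
  have ht' : Monotone t' := fun a b hab => ht (by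
    rw [Fin.mk_le_mk]; omega)
  have h1 : ∀ i : Fin n, t' (i + 1) = t i.succ := fun i =>
    congrArg t (Fin.ext (by simp only [Fin.val_succ]; omega))
  have h2 : ∀ i : Fin n, t' i = t i.castSucc := fun i =>
    congrArg t (Fin.ext (by simp only [Fin.val_castSucc]; omega))
  set v' : ℕ → ℝ := fun k => if h : k < n then v ⟨k, h⟩ else 0
  have hv : ∀ i : Fin n, v' i = v i := fun i => by simp [v']
  have key := hY.integral_exp_increments hg ht' v' n
  simp_rw [Finset.sum_range, h1, h2, hv] at key
  rw [charFun_apply, integral_map (Measurable.aemeasurable (by fun_prop))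
    (Continuous.aestronglyMeasurable (by fun_prop))]
  simp_rw [PiLp.inner_apply]
  have e : ∀ i : Fin n, charFun (P.map fun ω => Y (t i.succ) ω - Y (t i.castSucc) ω) (v i) =
      Complex.exp ((((t i.succ : ℝ) - t i.castSucc) * g (v i) : ℝ) : ℂ) :=
    fun i => hY.charFun_map_sub hg (ht (Fin.castSucc_le_succ i)) _
  simp_rw [e]
  rw [← Complex.exp_sum, ← Complex.ofReal_sum, ← key]
  simp

theorem ae_zero [IsProbabilityMeasure P] (hY : HasExponent P Y g) (hg : g 0 = 0) : ∀ᵐ ω ∂P, Y 0 ω = 0 := by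
  have : IsProbabilityMeasure (P.map (Y 0)) :=
    Measure.isProbabilityMeasure_map (hY.measurable 0).aemeasurable
  have h : P.map (Y 0) = Measure.dirac 0 := by
    refine Measure.ext_of_charFun ?_
    ext u
    rw [hY.charFun_map_apply hg, charFun_dirac]
    simp
  have h2 : ∀ᵐ x ∂(P.map (Y 0)), x = 0 := by
    rw [h]
    simp [ae_dirac_eq]
  exact ae_of_ae_map (hY.measurable 0).aemeasurable h2

theorem identDistrib_sub [IsProbabilityMeasure P] (hY : HasExponent P Y g) (hg : g 0 = 0) (s h : ℝ≥0) :
    IdentDistrib (fun ω => Y (s + h) ω - Y s ω) (Y h) P P := by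
  have hm := (hY.measurable (s + h)).sub (hY.measurable s)
  refine ⟨hm.aemeasurable, (hY.measurable h).aemeasurable, ?_⟩
  have := Measure.isProbabilityMeasure_map (μ := P) hm.aemeasurable
  have := Measure.isProbabilityMeasure_map (μ := P) (hY.measurable h).aemeasurable
  refine Measure.ext_of_charFun ?_
  ext u
  rw [hY.charFun_map_apply hg]
  refine (hY.charFun_map_sub hg (le_add_right le_rfl) u).trans ?_
  simp

/-- By `1 - e^y ≤ -y`, the quadratic bound on `-g` passes to the characteristic function of `∑ c_s
Y_s`. This is the substitute for the Itô isometry on which the random integral rests. -/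
theorem lintegral_sq_le [IsProbabilityMeasure P] (hY : HasExponent P Y g) {K : ℝ} (hg0 : ∀ u, 0 ≤ -g u)
    (hgK : ∀ u, -g u ≤ K * u ^ 2 / 2) (c : ℝ≥0 →₀ ℝ) :
    ∫⁻ ω, ENNReal.ofReal (Finsupp.linearCombination ℝ Y c ω ^ 2) ∂P ≤
      ENNReal.ofReal (K * ∫ r, stepFun c r ^ 2) := by
  have hm := hY.measurable_linearCombination c
  have := Measure.isProbabilityMeasure_map (μ := P) hm.aemeasurable
  have h := lintegral_sq_le_of_charFun (ν := P.map (Finsupp.linearCombination ℝ Y c))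
    (K := K * ∫ r, stepFun c r ^ 2) (fun u => ?_)
  · rwa [lintegral_map (by fun_prop) hm] at h
  · rw [hY.charFun_map, Complex.exp_ofReal_re]
    have hsq : Integrable (fun r => stepFun c r ^ 2) := (memLp_stepFun c).integrable_sq
    have h1 : ∫ r, -g (u * stepFun c r) ≤ ∫ r, K * u ^ 2 / 2 * stepFun c r ^ 2 := by
      refine integral_mono_of_nonneg (ae_of_all _ fun r => hg0 _) (hsq.const_mul _)
        (ae_of_all _ fun r => (hgK _).trans (le_of_eq ?_))
      ring
    rw [integral_neg, integral_const_mul] at h1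
    have h2 := Real.add_one_le_exp (∫ r, g (u * stepFun c r))
    linarith

end HasExponent

/-! ### The random integral -/

/-- Extension by uniform continuity: a map dominated by `A` has values at the points of
`closure (range A)`. -/
theorem exists_dist_le_of_mem_closure {V M₁ M₂ : Type*} [PseudoMetricSpace M₁]
    [PseudoMetricSpace M₂] [CompleteSpace M₂] {A : V → M₁} {B : V → M₂} {K : ℝ}
    (h : ∀ c c', dist (B c) (B c') ≤ K * dist (A c) (A c')) {k : M₁}
    (hk : k ∈ closure (Set.range A)) : ∃ z, ∀ c, dist (B c) z ≤ K * dist (A c) k := by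
  obtain ⟨x, hx, hlim⟩ := mem_closure_iff_seq_limit.1 hk
  choose c hc using hx
  obtain rfl : (fun n => A (c n)) = x := funext hc
  have hcau : CauchySeq fun n => B (c n) := by
    rw [cauchySeq_iff_tendsto_dist_atTop_0]
    have h1 := (cauchySeq_iff_tendsto_dist_atTop_0.1 hlim.cauchySeq).const_mul K
    rw [mul_zero] at h1
    exact squeeze_zero (fun _ => dist_nonneg) (fun _ => h _ _) h1
  obtain ⟨z, hz⟩ := cauchySeq_tendsto_of_complete hcau
  exact ⟨z, fun d => le_of_tendsto_of_tendsto' (tendsto_const_nhds.dist hz)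
    ((tendsto_const_nhds.dist hlim).const_mul K) fun n => h d (c n)⟩

/-- The extended map keeps the Lipschitz constant `K`; this carries the convergence of the truncated
kernels over to their integrals. -/
theorem dist_le_of_mem_closure {V M₁ M₂ : Type*} [PseudoMetricSpace M₁]
    [PseudoMetricSpace M₂] {A : V → M₁} {B : V → M₂} {K : ℝ} {k k' : M₁}
    (hk : k ∈ closure (Set.range A)) {z z' : M₂} (hz : ∀ c, dist (B c) z ≤ K * dist (A c) k)
    (hz' : ∀ c, dist (B c) z' ≤ K * dist (A c) k') : dist z z' ≤ K * dist k k' := by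
  obtain ⟨x, hx, hlim⟩ := mem_closure_iff_seq_limit.1 hk
  choose c hc using hx
  obtain rfl : (fun n => A (c n)) = x := funext hc
  have h1 : Tendsto (fun n => K * dist (A (c n)) k + K * dist (A (c n)) k') atTop
      (𝓝 (K * dist k k + K * dist k k')) :=
    ((hlim.dist tendsto_const_nhds).const_mul K).add ((hlim.dist tendsto_const_nhds).const_mul K)
  rw [dist_self, mul_zero, zero_add] at h1
  refine ge_of_tendsto' h1 fun n => ?_
  calc dist z z' ≤ dist z (B (c n)) + dist (B (c n)) z' := dist_triangle _ _ _
    _ ≤ _ := by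
      rw [dist_comm z]
      exact add_le_add (hz _) (hz' _)

theorem abs_exp_neg_sub_exp_neg_le {x y : ℝ} (hx : 0 ≤ x) (hy : 0 ≤ y) :
    |Real.exp (-x) - Real.exp (-y)| ≤ |x - y| := by
  wlog hxy : x ≤ y generalizing x y
  · rw [abs_sub_comm, abs_sub_comm x]
    exact this hy hx (le_of_not_ge hxy)
  have h1 : Real.exp (-y) ≤ Real.exp (-x) := Real.exp_le_exp.2 (by linarith)
  have h2 : Real.exp (-y) = Real.exp (-x) * Real.exp (-(y - x)) := by
    rw [← Real.exp_add]
    ring_nf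
  have h3 := Real.one_sub_le_exp_neg (y - x)
  have h4 : Real.exp (-x) ≤ 1 := Real.exp_le_one_iff.2 (by linarith)
  have h5 := Real.exp_pos (-x)
  rw [abs_of_nonneg (by linarith), abs_sub_comm, abs_of_nonneg (by linarith), h2]
  nlinarith

/-- `e^{-r}` on `(0, ∞)`. -/
def expTail (r : ℝ) : ℝ := (Set.Ioi (0 : ℝ)).indicator (fun r => Real.exp (-r)) r

theorem memLp_expTail : MemLp expTail 2 volume := by
  have hm : Measurable expTail := Measurable.indicator (by fun_prop) measurableSet_Ioi
  rw [memLp_two_iff_integrable_sq hm.aestronglyMeasurable]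
  have : (fun r => expTail r ^ 2) =
      (Set.Ioi (0 : ℝ)).indicator fun r => Real.exp (-2 * r) := by
    ext r
    by_cases h : r ∈ Set.Ioi (0 : ℝ)
    · simp only [expTail, Set.indicator_of_mem h]
      rw [← Real.exp_nat_mul]
      congr 1
      push_cast
      ring
    · simp [expTail, Set.indicator_of_notMem h]
  rw [this, integrable_indicator_iff measurableSet_Ioi]
  exact exp_neg_integrableOn_Ioi 0 (by norm_num)

/-- `e^{-r}` on `(0, T]`. -/
def expTrunc (T : ℝ≥0) : ℝ → ℝ := (Set.Iic (T : ℝ)).indicator expTail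

theorem memLp_expTrunc (T : ℝ≥0) : MemLp (expTrunc T) 2 volume :=
  memLp_expTail.indicator measurableSet_Iic

theorem expTrunc_eq (T : ℝ≥0) (r : ℝ) :
    expTrunc T r = Real.exp (-r) * (Set.Ioc (0 : ℝ) T).indicator (fun _ => 1) r := by
  by_cases h : 0 < r <;> by_cases h' : r ≤ T <;>
    simp [expTrunc, expTail, h, h']

/-- The coefficients of a Riemann-Stieltjes sum with integrand `e^{-s}`. -/
def TaggedPartition.coeff {T : ℝ≥0} (π : TaggedPartition T) : ℝ≥0 →₀ ℝ :=
  incrementCoeff π.point (fun i => Real.exp (-(π.tag i : ℝ))) π.n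

theorem TaggedPartition.riemannSum_eq {T : ℝ≥0} (π : TaggedPartition T) {Ω : Type}
    (Y : ℝ≥0 → Ω → ℝ) (ω : Ω) : π.riemannSum (fun s => Real.exp (-s)) Y ω =
      Finsupp.linearCombination ℝ Y π.coeff ω := by
  rw [TaggedPartition.coeff, linearCombination_incrementCoeff, TaggedPartition.riemannSum]

/-- A Riemann sum is the image of the step function equal to `e^{-τ_i}` on the `i`-th cell, and
`e^{-r}` is 1-Lipschitz on `[0,∞)`, so the error is at most the mesh. -/
theorem TaggedPartition.abs_stepFun_coeff_sub_le {T : ℝ≥0} (π : TaggedPartition T) {δ : ℝ}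
    (hπ : π.MeshLE δ) (r : ℝ) :
    |stepFun π.coeff r - expTrunc T r| ≤ (Set.Ioc (0 : ℝ) T).indicator (fun _ => δ) r := by
  have hmono : ∀ i < π.n, π.point i ≤ π.point (i + 1) := fun i hi =>
    (π.point_le_tag i hi).trans (π.tag_le_point i hi)
  set J : ℕ → Set ℝ := fun i => Set.Ioc (π.point i : ℝ) (π.point (i + 1))
  -- The cells cover `(0,T]` exactly once: with all coefficients equal to `1`, the increments
  -- telescope.
  have hcover : ∑ i ∈ Finset.range π.n, (J i).indicator (fun _ => (1 : ℝ)) r =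
      (Set.Ioc (0 : ℝ) T).indicator (fun _ => 1) r := by
    rw [← stepFun_incrementCoeff π.point (fun _ => 1) π.n hmono, incrementCoeff,
      Finset.sum_range_sub fun i => Finsupp.single (π.point i) (1 : ℝ), π.point_n, π.point_zero,
      map_sub, Pi.sub_apply, stepFun_single, stepFun_single]
    simp
  rw [TaggedPartition.coeff, stepFun_incrementCoeff _ _ _ hmono, expTrunc_eq, ← hcover,
    Finset.mul_sum, ← Finset.sum_sub_distrib]
  have hδ : (Set.Ioc (0 : ℝ) T).indicator (fun _ => δ) r =
      ∑ i ∈ Finset.range π.n, δ * (J i).indicator (fun _ => (1 : ℝ)) r := by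
    rw [← Finset.mul_sum, hcover]
    by_cases h : r ∈ Set.Ioc (0 : ℝ) T <;> simp [h]
  rw [hδ]
  refine (Finset.abs_sum_le_sum_abs _ _).trans (Finset.sum_le_sum fun i hi => ?_)
  have hi := Finset.mem_range.1 hi
  by_cases h : r ∈ J i
  · simp only [J] at h
    simp only [J, Set.indicator_of_mem h, mul_one]
    have h1 : (π.point i : ℝ) ≤ π.tag i := NNReal.coe_le_coe.2 (π.point_le_tag i hi)
    have h2 : (π.tag i : ℝ) ≤ π.point (i + 1) := NNReal.coe_le_coe.2 (π.tag_le_point i hi)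
    have h3 := hπ i hi
    have h0 : (0 : ℝ) ≤ π.point i := NNReal.coe_nonneg _
    refine (abs_exp_neg_sub_exp_neg_le (h0.trans h1) (h0.trans h.1.le)).trans ?_
    have := h.1
    have := h.2
    rw [abs_le]
    constructor <;> linarith
  · simp only [J] at h
    simp [J, Set.indicator_of_notMem h]

/-- The partition of `[0, T]` into `n + 1` equal intervals, with given tags. -/
def uniformPartition (T : ℝ≥0) (n : ℕ) (tag : ℕ → ℝ≥0)
    (h : ∀ i : ℕ, tag i ∈ Set.Icc (T * (i / (n + 1))) (T * ((i + 1 : ℕ) / (n + 1)))) :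
    TaggedPartition T where
  n := n + 1
  point i := T * (i / (n + 1))
  tag := tag
  point_zero := by simp
  point_n := by
    rw [Nat.cast_add_one, div_self (by positivity), mul_one]
  point_le_tag i _ := (h i).1
  tag_le_point i _ := (h i).2

theorem uniformPartition_meshLE (T : ℝ≥0) (n : ℕ) (tag : ℕ → ℝ≥0) (h) :
    (uniformPartition T n tag h).MeshLE (T * (1 / ((n : ℝ) + 1))) := by
  intro i _
  simp only [uniformPartition]
  push_cast
  rw [← mul_sub]
  apply le_of_eq
  congr 1
  ring

theorem monotone_uniformPartition (T : ℝ≥0) (n : ℕ) :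
    Monotone fun i : ℕ => T * ((i : ℝ≥0) / (n + 1)) := by
  intro i j hij
  have : (i : ℝ≥0) ≤ j := Nat.cast_le.2 hij
  dsimp only
  gcongr

/-! ### `L²` estimates for characteristic functions and probabilities. -/

section Lp

variable {Ω : Type*} [MeasurableSpace Ω] {P : Measure Ω}

/-- Lipschitz with constant `|u|`, by `|e^{ia} - e^{ib}| ≤ |a - b|` and the domination of the `L¹`
norm by the `L²` norm under a probability measure. -/
theorem continuous_charFun_map_Lp [IsProbabilityMeasure P] (u : ℝ) :
    Continuous fun f : Lp ℝ 2 P => charFun (P.map f) u := by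
  have hexp : ∀ f : Lp ℝ 2 P, Integrable (fun ω => Complex.exp (u * f ω * Complex.I)) P := by
    intro f
    have : Measurable f := (Lp.stronglyMeasurable f).measurable
    refine Integrable.of_bound (C := 1)
      (Measurable.aestronglyMeasurable (by fun_prop)) (ae_of_all _ fun ω => ?_)
    rw [← Complex.ofReal_mul, Complex.norm_exp_ofReal_mul_I]
  have hch : ∀ f : Lp ℝ 2 P, charFun (P.map f) u = ∫ ω, Complex.exp (u * f ω * Complex.I) ∂P := by
    intro f
    rw [charFun_apply_real, integral_map (Lp.stronglyMeasurable f).measurable.aemeasurable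
      (Continuous.aestronglyMeasurable (by fun_prop))]
  simp_rw [hch]
  refine LipschitzWith.continuous (K := ‖u‖₊) (LipschitzWith.of_dist_le_mul fun f f' => ?_)
  have hi : Integrable (fun ω => f ω - f' ω) P :=
    ((Lp.memLp f).integrable (by norm_num)).sub ((Lp.memLp f').integrable (by norm_num))
  have hb : ∀ a b : ℝ, ‖Complex.exp (a * Complex.I) - Complex.exp (b * Complex.I)‖ ≤ |a - b| := by
    intro a b
    have : Complex.exp (a * Complex.I) - Complex.exp (b * Complex.I) =
        Complex.exp (b * Complex.I) * (Complex.exp (Complex.I * (a - b : ℝ)) - 1) := by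
      rw [mul_sub, mul_one, ← Complex.exp_add]
      congr 2
      push_cast
      ring
    rw [this, norm_mul, Complex.norm_exp_ofReal_mul_I, one_mul]
    exact Real.norm_exp_I_mul_ofReal_sub_one_le
  rw [dist_eq_norm, ← integral_sub (hexp f) (hexp f')]
  calc ‖∫ ω, (Complex.exp (u * f ω * Complex.I) - Complex.exp (u * f' ω * Complex.I)) ∂P‖
      ≤ ∫ ω, |u| * ‖f ω - f' ω‖ ∂P := by
        refine norm_integral_le_of_norm_le (hi.norm.const_mul _) (ae_of_all _ fun ω => ?_)
        have := hb (u * f ω) (u * f' ω)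
        push_cast at this
        rwa [← mul_sub, abs_mul] at this
    _ = |u| * (eLpNorm (fun ω => f ω - f' ω) 1 P).toReal := by
        rw [integral_const_mul, integral_norm_eq_lintegral_enorm hi.aestronglyMeasurable,
          eLpNorm_one_eq_lintegral_enorm]
    _ ≤ ‖u‖₊ * dist f f' := by
        rw [Lp.dist_def]
        refine mul_le_mul_of_nonneg_left (ENNReal.toReal_mono ?_ ?_) (abs_nonneg u)
        · exact ((Lp.memLp f).sub (Lp.memLp f')).eLpNorm_ne_top
        · exact eLpNorm_le_eLpNorm_of_exponent_le (by norm_num) hi.aestronglyMeasurable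

/-- Chebyshev's inequality. -/
theorem measure_ge_abs_le_of_eLpNorm_le {f : Ω → ℝ} (hf : AEStronglyMeasurable f P) {d ε : ℝ}
    (hd : eLpNorm f 2 P ≤ ENNReal.ofReal d) (hd0 : 0 ≤ d) (hε : 0 < ε) :
    P {ω | ε ≤ |f ω|} ≤ ENNReal.ofReal ((d / ε) ^ 2) := by
  have h := meas_ge_le_mul_pow_eLpNorm_enorm (p := 2) P (by norm_num) (by norm_num) hf
    (ε := ENNReal.ofReal ε) (by simpa using hε) (by simp)
  have hset : {ω | ε ≤ |f ω|} = {ω | ENNReal.ofReal ε ≤ ‖f ω‖ₑ} := by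
    ext ω
    simp only [Set.mem_ofPred_eq]
    rw [← ofReal_norm, ENNReal.ofReal_le_ofReal_iff (norm_nonneg _), Real.norm_eq_abs]
  rw [hset]
  refine h.trans ?_
  simp only [ENNReal.toReal_ofNat, ENNReal.rpow_ofNat]
  rw [← mul_pow, ENNReal.ofReal_pow (by positivity), div_eq_inv_mul,
    ENNReal.ofReal_mul (by positivity), ENNReal.ofReal_inv_of_pos hε]
  gcongr

end Lp

theorem TaggedPartition.eLpNorm_stepFun_coeff_sub_le {T : ℝ≥0} (π : TaggedPartition T) {δ : ℝ}
    (hδ : 0 ≤ δ) (hπ : π.MeshLE δ) :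
    eLpNorm (stepFun π.coeff - expTrunc T) 2 volume ≤ ENNReal.ofReal (δ * √T) := by
  refine (eLpNorm_mono_real (g := (Set.Ioc (0 : ℝ) T).indicator fun _ => δ) fun r => ?_).trans ?_
  · exact π.abs_stepFun_coeff_sub_le hπ r
  · rw [eLpNorm_indicator_const measurableSet_Ioc (by norm_num) (by norm_num), Real.volume_Ioc,
      sub_zero, Real.enorm_of_nonneg hδ, ENNReal.ofReal_mul hδ, Real.sqrt_eq_rpow,
      ENNReal.ofReal_rpow_of_nonneg (NNReal.coe_nonneg T) (by norm_num)]
    simp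

/-- The part of `e^{-r}` beyond `T` is `e^{-T}` times the translate of `expTail` by `T`. -/
theorem eLpNorm_expTrunc_sub_expTail_le (T : ℝ≥0) :
    eLpNorm (expTrunc T - expTail) 2 volume ≤
      ENNReal.ofReal (Real.exp (-T)) * eLpNorm expTail 2 volume := by
  have hm : AEStronglyMeasurable expTail volume := memLp_expTail.1
  have hmp : MeasurePreserving (fun r : ℝ => r - T) volume volume :=
    measurePreserving_sub_right volume (T : ℝ)
  rw [← eLpNorm_comp_measurePreserving hm hmp]
  refine eLpNorm_le_mul_eLpNorm_of_ae_le_mul (ae_of_all _ fun r => ?_) 2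
  simp only [Pi.sub_apply, expTrunc, Function.comp_apply, expTail, Set.indicator_apply,
    Set.mem_Iic, Set.mem_Ioi, sub_pos, Real.norm_eq_abs]
  have hT := NNReal.coe_nonneg T
  by_cases h : r ≤ T
  · simp [h, not_lt.2 h]
  · have h' : (T : ℝ) < r := not_le.1 h
    have h0 : 0 < r := lt_of_le_of_lt hT h'
    simp only [h, h', h0, if_true, if_false, zero_sub, abs_neg, Real.abs_exp]
    rw [← Real.exp_add]
    apply le_of_eq
    congr 1
    ring

namespace HasExponent

variable {Ω : Type} [MeasurableSpace Ω] {P : Measure Ω} [IsProbabilityMeasure P]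
  {Y : ℝ≥0 → Ω → ℝ} {g : ℝ → ℝ} {K : ℝ}

theorem eLpNorm_linearCombination_le (hY : HasExponent P Y g) (hg0 : ∀ u, 0 ≤ -g u)
    (hgK : ∀ u, -g u ≤ K * u ^ 2 / 2) (c : ℝ≥0 →₀ ℝ) :
    eLpNorm (Finsupp.linearCombination ℝ Y c) 2 P ≤
      ENNReal.ofReal √K * eLpNorm (stepFun c) 2 volume := by
  have hK : 0 ≤ K := by
    have := (hg0 1).trans (hgK 1)
    linarith
  have h := hY.lintegral_sq_le hg0 hgK c
  have hsq : ∀ x : ℝ, ENNReal.ofReal (x ^ 2) = ‖x‖ₑ ^ 2 := fun x => by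
    rw [← sq_abs, ENNReal.ofReal_pow (abs_nonneg _), Real.enorm_eq_ofReal_abs]
  rw [ENNReal.ofReal_mul hK, ofReal_integral_eq_lintegral_ofReal
    (memLp_stepFun c).integrable_sq (ae_of_all _ fun r => sq_nonneg _)] at h
  simp_rw [hsq] at h
  rw [eLpNorm_eq_lintegral_rpow_enorm_toReal (by norm_num) (by norm_num),
    eLpNorm_eq_lintegral_rpow_enorm_toReal (by norm_num) (by norm_num)]
  simp only [ENNReal.toReal_ofNat, ENNReal.rpow_ofNat]
  rw [Real.sqrt_eq_rpow, ← ENNReal.ofReal_rpow_of_nonneg hK (by norm_num),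
    ← ENNReal.mul_rpow_of_nonneg _ _ (by norm_num)]
  exact ENNReal.rpow_le_rpow h (by norm_num)

theorem memLp_linearCombination (hY : HasExponent P Y g) (hg0 : ∀ u, 0 ≤ -g u)
    (hgK : ∀ u, -g u ≤ K * u ^ 2 / 2) (c : ℝ≥0 →₀ ℝ) :
    MemLp (Finsupp.linearCombination ℝ Y c) 2 P :=
  ⟨(hY.measurable_linearCombination c).aestronglyMeasurable,
    (hY.eLpNorm_linearCombination_le hg0 hgK c).trans_lt
      (ENNReal.mul_lt_top ENNReal.ofReal_lt_top (memLp_stepFun c).2)⟩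

theorem dist_toLp_le (hY : HasExponent P Y g) (hg0 : ∀ u, 0 ≤ -g u)
    (hgK : ∀ u, -g u ≤ K * u ^ 2 / 2) (c c' : ℝ≥0 →₀ ℝ) :
    dist ((hY.memLp_linearCombination hg0 hgK c).toLp) ((hY.memLp_linearCombination hg0 hgK c').toLp)
      ≤ √K * dist ((memLp_stepFun c).toLp) ((memLp_stepFun c').toLp) := by
  have h := hY.eLpNorm_linearCombination_le hg0 hgK (c - c')
  rw [map_sub, map_sub] at h
  rw [dist_edist, dist_edist, Lp.edist_toLp_toLp, Lp.edist_toLp_toLp,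
    ← ENNReal.toReal_ofReal (Real.sqrt_nonneg K), ← ENNReal.toReal_mul]
  exact ENNReal.toReal_mono (ENNReal.mul_ne_top ENNReal.ofReal_ne_top
    ((memLp_stepFun c).sub (memLp_stepFun c')).eLpNorm_ne_top) h

/-- `Y t - Y s` comes from a step function bounded by the indicator of the interval between `s` and
`t`, so its `L²` norm is at most `√(K |t - s|)`. -/
theorem tendstoInMeasure (hY : HasExponent P Y g) (hg0 : ∀ u, 0 ≤ -g u)
    (hgK : ∀ u, -g u ≤ K * u ^ 2 / 2) (s : ℝ≥0) : TendstoInMeasure P Y (𝓝 s) (Y s) := by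
  refine tendstoInMeasure_of_tendsto_eLpNorm (p := 2) (by norm_num)
    (fun t => (hY.measurable t).aestronglyMeasurable) (hY.measurable s).aestronglyMeasurable ?_
  have hle : ∀ t, eLpNorm (Y t - Y s) 2 P ≤
      ENNReal.ofReal √K * ENNReal.ofReal |(t : ℝ) - s| ^ (1 / 2 : ℝ) := by
    intro t
    have h := hY.eLpNorm_linearCombination_le hg0 hgK
      (Finsupp.single t 1 - Finsupp.single s 1)
    rw [map_sub, Finsupp.linearCombination_single, Finsupp.linearCombination_single, one_smul,
      one_smul] at h
    refine h.trans ?_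
    gcongr
    refine (eLpNorm_mono_real (g := (Set.uIoc (s : ℝ) t).indicator fun _ => 1) fun r => ?_).trans ?_
    · rw [map_sub, Pi.sub_apply, stepFun_single, stepFun_single, Real.norm_eq_abs]
      have h1 := NNReal.coe_nonneg s
      have h2 := NNReal.coe_nonneg t
      by_cases hr : r ∈ Set.uIoc (s : ℝ) t
      · rw [Set.indicator_of_mem hr]
        simp only [Set.indicator_apply]
        split_ifs <;> simp
      · rw [Set.indicator_of_notMem hr]
        rw [Set.mem_uIoc] at hr
        simp only [Set.indicator_apply, Set.mem_Ioc]
        split_ifs <;> first | (exfalso; grind) | simp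
    · rw [eLpNorm_indicator_const measurableSet_uIoc (by norm_num) (by norm_num), Set.uIoc,
        Real.volume_Ioc, max_sub_min_eq_abs]
      simp
  have hlim : Tendsto (fun t : ℝ≥0 => ENNReal.ofReal √K *
      ENNReal.ofReal |(t : ℝ) - s| ^ (1 / 2 : ℝ)) (𝓝 s)
      (𝓝 (ENNReal.ofReal √K * ENNReal.ofReal |(s : ℝ) - s| ^ (1 / 2 : ℝ))) := by
    refine ENNReal.Tendsto.const_mul ?_ (Or.inr ENNReal.ofReal_ne_top)
    refine (ENNReal.continuous_rpow_const.tendsto _).comp (ENNReal.tendsto_ofReal ?_)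
    exact Continuous.tendsto (f := fun t : ℝ≥0 => |(t : ℝ) - s|) (by fun_prop) s
  rw [sub_self, abs_zero, ENNReal.ofReal_zero, ENNReal.zero_rpow_of_pos (by norm_num),
    mul_zero] at hlim
  exact tendsto_of_tendsto_of_tendsto_of_le_of_le tendsto_const_nhds hlim (fun _ => zero_le)
    hle

theorem isLevyProcess (hY : HasExponent P Y g) (hg : g 0 = 0) (hg0 : ∀ u, 0 ≤ -g u)
    (hgK : ∀ u, -g u ≤ K * u ^ 2 / 2) : IsLevyProcess P Y where
  measurable := hY.measurable
  zero := hY.ae_zero hg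
  indep_increments := hY.hasIndepIncrements hg
  stationary_increments := hY.identDistrib_sub hg
  continuous_in_probability := hY.tendstoInMeasure hg0 hgK

end HasExponent

/-! ### Exact Riemann sums and `L²` approximation of the exponential kernel. -/

/-- Mean value theorem for `s ↦ L(e^{-s} u)`. -/
theorem exists_tag {L g : ℝ → ℝ}
    (hL : ∀ u s, HasDerivAt (fun s => L (Real.exp (-s) * u)) (-g (Real.exp (-s) * u)) s)
    (u : ℝ) {a b : ℝ≥0} (hab : a ≤ b) : ∃ τ ∈ Set.Icc a b,
      ((b : ℝ) - a) * g (Real.exp (-(τ : ℝ)) * u) =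
        L (Real.exp (-(a : ℝ)) * u) - L (Real.exp (-(b : ℝ)) * u) := by
  rcases hab.eq_or_lt with rfl | hlt
  · exact ⟨a, by simp, by simp⟩
  · obtain ⟨τ, hτ, h⟩ := exists_hasDerivAt_eq_slope (fun s => L (Real.exp (-s) * u))
      (fun s => -g (Real.exp (-s) * u)) (NNReal.coe_lt_coe.2 hlt)
      (fun s _ => (hL u s).continuousAt.continuousWithinAt) (fun s _ => hL u s)
    lift τ to ℝ≥0 using (NNReal.coe_nonneg a).trans hτ.1.le
    refine ⟨τ, ⟨NNReal.coe_le_coe.1 hτ.1.le, NNReal.coe_le_coe.1 hτ.2.le⟩, ?_⟩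
    have hne : (b : ℝ) - a ≠ 0 := (sub_pos.2 (NNReal.coe_lt_coe.2 hlt)).ne'
    rw [eq_div_iff hne] at h
    linarith

/-- Uniform partitions for which the Riemann sums of `g(e^{-s} u)` are exact. -/
theorem exists_uniformPartition {L g : ℝ → ℝ}
    (hL : ∀ u s, HasDerivAt (fun s => L (Real.exp (-s) * u)) (-g (Real.exp (-s) * u)) s)
    (u : ℝ) (T : ℝ≥0) (n : ℕ) : ∃ π : TaggedPartition T,
      π.MeshLE (T * (1 / ((n : ℝ) + 1))) ∧ Monotone π.point ∧
      ∑ i ∈ Finset.range π.n, ((π.point (i + 1) : ℝ) - π.point i) *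
        g (Real.exp (-(π.tag i : ℝ)) * u) = L u - L (Real.exp (-(T : ℝ)) * u) := by
  -- Tags from the mean value theorem make each term an increment of `s ↦ L(e^{-s}u)`, so the sum
  -- telescopes and no integral of `g` has to be evaluated.
  have h := fun i : ℕ => exists_tag hL u (monotone_uniformPartition T n (Nat.le_succ i))
  choose τ hτ hsum using h
  let π := uniformPartition T n τ hτ
  refine ⟨π, uniformPartition_meshLE T n τ hτ, monotone_uniformPartition T n, ?_⟩
  have : ∀ i, ((π.point (i + 1) : ℝ) - π.point i) * g (Real.exp (-(π.tag i : ℝ)) * u) =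
      L (Real.exp (-(π.point i : ℝ)) * u) - L (Real.exp (-(π.point (i + 1) : ℝ)) * u) := hsum
  simp_rw [this]
  rw [Finset.sum_range_sub' fun i => L (Real.exp (-(π.point i : ℝ)) * u), π.point_zero, π.point_n]
  simp

theorem tendsto_toLp_stepFun_coeff {T : ℝ≥0} (π : ℕ → TaggedPartition T)
    (hπ : ∀ n, (π n).MeshLE (T * (1 / ((n : ℝ) + 1)))) :
    Tendsto (fun n => (memLp_stepFun (π n).coeff).toLp) atTop (𝓝 (memLp_expTrunc T).toLp) := by
  rw [tendsto_iff_edist_tendsto_0]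
  simp_rw [Lp.edist_toLp_toLp]
  have hlim : Tendsto (fun n : ℕ => ENNReal.ofReal (T * (1 / ((n : ℝ) + 1)) * √T)) atTop
      (𝓝 (ENNReal.ofReal (T * 0 * √T))) :=
    ENNReal.tendsto_ofReal ((tendsto_one_div_add_atTop_nhds_zero_nat.const_mul _).mul_const _)
  rw [mul_zero, zero_mul, ENNReal.ofReal_zero] at hlim
  exact tendsto_of_tendsto_of_tendsto_of_le_of_le tendsto_const_nhds hlim (fun _ => zero_le)
    fun n => (π n).eLpNorm_stepFun_coeff_sub_le (by positivity) (hπ n)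

theorem expTrunc_mem_closure (T : ℝ≥0) :
    (memLp_expTrunc T).toLp ∈ closure (Set.range fun c => (memLp_stepFun c).toLp) := by
  -- Only the partitions matter here, hence `L = g = 0`.
  have h := fun n => exists_uniformPartition (L := fun _ => 0) (g := fun _ => 0)
    (fun _ s => by simpa using hasDerivAt_const s (0 : ℝ)) 0 T n
  choose π hπ _ _ using h
  exact mem_closure_of_tendsto (tendsto_toLp_stepFun_coeff π hπ)
    (Eventually.of_forall fun n => ⟨_, rfl⟩)

theorem dist_expTrunc_expTail_le (T : ℝ≥0) :
    dist (memLp_expTrunc T).toLp memLp_expTail.toLp ≤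
      Real.exp (-T) * (eLpNorm expTail 2 volume).toReal := by
  rw [dist_edist, Lp.edist_toLp_toLp, ← ENNReal.toReal_ofReal (Real.exp_pos (-(T : ℝ))).le,
    ← ENNReal.toReal_mul]
  exact ENNReal.toReal_mono (ENNReal.mul_ne_top ENNReal.ofReal_ne_top memLp_expTail.2.ne)
    (eLpNorm_expTrunc_sub_expTail_le T)

theorem tendsto_expTrunc :
    Tendsto (fun T : ℝ≥0 => (memLp_expTrunc T).toLp) atTop (𝓝 memLp_expTail.toLp) := by
  rw [tendsto_iff_dist_tendsto_zero]
  refine squeeze_zero (fun _ => dist_nonneg) dist_expTrunc_expTail_le ?_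
  have : Tendsto (fun T : ℝ≥0 => Real.exp (-(T : ℝ))) atTop (𝓝 0) :=
    Real.tendsto_exp_neg_atTop_nhds_zero.comp (NNReal.tendsto_coe_atTop.2 tendsto_id)
  simpa using this.mul_const (eLpNorm expTail 2 volume).toReal

theorem expTail_mem_closure :
    memLp_expTail.toLp ∈ closure (Set.range fun c => (memLp_stepFun c).toLp) :=
  isClosed_closure.mem_of_tendsto tendsto_expTrunc (Eventually.of_forall expTrunc_mem_closure)

namespace HasExponent

variable {Ω : Type} [MeasurableSpace Ω] {P : Measure Ω} [IsProbabilityMeasure P]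
  {Y : ℝ≥0 → Ω → ℝ} {g : ℝ → ℝ} {K : ℝ}

/-- A partition of mesh `δ` has its step function within `δ√T` of the kernel in `L²`; the Lipschitz
bound `hz` and Chebyshev's inequality turn this into convergence in probability. -/
theorem isRandomIntegral (hY : HasExponent P Y g) (hg0 : ∀ u, 0 ≤ -g u)
    (hgK : ∀ u, -g u ≤ K * u ^ 2 / 2) {T : ℝ≥0} {z : Lp ℝ 2 P}
    (hz : ∀ c, dist ((hY.memLp_linearCombination hg0 hgK c).toLp) z ≤
      √K * dist ((memLp_stepFun c).toLp) (memLp_expTrunc T).toLp) :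
    IsRandomIntegral P (fun s => Real.exp (-s)) Y T z := by
  refine ⟨(Lp.stronglyMeasurable z).measurable, fun ε hε η hη => ?_⟩
  have hlim : Tendsto (fun δ : ℝ => ENNReal.ofReal ((√K * (δ * √T) / ε) ^ 2)) (𝓝[>] 0) (𝓝 0) := by
    have : Continuous fun δ : ℝ => ENNReal.ofReal ((√K * (δ * √T) / ε) ^ 2) :=
      ENNReal.continuous_ofReal.comp (by fun_prop)
    simpa using (this.tendsto 0).mono_left nhdsWithin_le_nhds
  obtain ⟨δ, hδη, hδ⟩ := ((hlim.eventually (Iio_mem_nhds hη)).and self_mem_nhdsWithin).exists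
  have hδ : 0 < δ := hδ
  refine ⟨δ, hδ, fun π hπ => ?_⟩
  simp_rw [TaggedPartition.riemannSum_eq]
  set f := Finsupp.linearCombination ℝ Y π.coeff
  have hmem := hY.memLp_linearCombination hg0 hgK π.coeff
  have hd : eLpNorm (f - ⇑z) 2 P ≤ ENNReal.ofReal (√K * (δ * √T)) := by
    have h1 := hz π.coeff
    have h2 : dist ((memLp_stepFun π.coeff).toLp) (memLp_expTrunc T).toLp ≤ δ * √T := by
      rw [dist_edist, Lp.edist_toLp_toLp]
      exact ENNReal.toReal_le_of_le_ofReal (by positivity)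
        (π.eLpNorm_stepFun_coeff_sub_le hδ.le hπ)
    have h3 : eLpNorm (f - ⇑z) 2 P = edist hmem.toLp z := by
      rw [Lp.edist_def]
      exact eLpNorm_congr_ae (hmem.coeFn_toLp.symm.sub ae_eq_rfl)
    rw [h3, edist_dist]
    exact ENNReal.ofReal_le_ofReal (h1.trans (mul_le_mul_of_nonneg_left h2 (Real.sqrt_nonneg K)))
  exact (measure_ge_abs_le_of_eLpNorm_le
    (hmem.1.sub (Lp.aestronglyMeasurable z)) hd (by positivity) hε).trans hδη.le

/-- Along the exact Riemann sums the characteristic function at `u` already equals the right side,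
so passing to the `L²` limit involves a constant sequence. The partitions depend on `u`, which is
harmless because `z` does not. -/
theorem charFun_randomIntegral (hY : HasExponent P Y g) (hg : g 0 = 0) (hg0 : ∀ u, 0 ≤ -g u)
    (hgK : ∀ u, -g u ≤ K * u ^ 2 / 2) {T : ℝ≥0} {z : Lp ℝ 2 P}
    (hz : ∀ c, dist ((hY.memLp_linearCombination hg0 hgK c).toLp) z ≤
      √K * dist ((memLp_stepFun c).toLp) (memLp_expTrunc T).toLp) {L : ℝ → ℝ}
    (hL : ∀ u s, HasDerivAt (fun s => L (Real.exp (-s) * u)) (-g (Real.exp (-s) * u)) s) (u : ℝ) :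
    charFun (P.map z) u = Complex.exp ((L u - L (Real.exp (-(T : ℝ)) * u) : ℝ) : ℂ) := by
  choose π hπ hmono hsum using exists_uniformPartition hL u T
  have hconv : Tendsto (fun n => (hY.memLp_linearCombination hg0 hgK (π n).coeff).toLp) atTop
      (𝓝 z) := by
    rw [tendsto_iff_dist_tendsto_zero]
    have h := (tendsto_iff_dist_tendsto_zero.1 (tendsto_toLp_stepFun_coeff π hπ)).const_mul √K
    rw [mul_zero] at h
    exact squeeze_zero (fun _ => dist_nonneg) (fun n => hz _) h
  have h1 := ((continuous_charFun_map_Lp u).tendsto z).comp hconv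
  refine tendsto_nhds_unique h1 (tendsto_const_nhds.congr fun n => ?_)
  have h2 := hY.integral_exp_increments hg (hmono n)
    (fun i => u * Real.exp (-((π n).tag i : ℝ))) (π n).n
  have h3 : ∀ i, u * Real.exp (-((π n).tag i : ℝ)) = Real.exp (-((π n).tag i : ℝ)) * u :=
    fun i => mul_comm _ _
  simp_rw [h3, hsum n] at h2
  rw [← h2, Function.comp_apply, Measure.map_congr (MemLp.coeFn_toLp _), charFun_apply_real,
    integral_map (hY.measurable_linearCombination _).aemeasurable
      (Continuous.aestronglyMeasurable (by fun_prop))]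
  congr 1
  ext ω
  rw [TaggedPartition.coeff, linearCombination_incrementCoeff]
  congr 2
  rw [← Complex.ofReal_mul, Finset.mul_sum]
  congr 1
  exact Finset.sum_congr rfl fun i _ => by ring

end HasExponent

/-! ### From an exponent to its background driving process. -/

/-- Data of an infinitely divisible law with exponent `g` and finite second moment, together with
`L = log φ` such that `g(t) = t L'(t)`. -/
structure IsDrivingExponent (g L : ℝ → ℝ) (K : ℝ) : Prop where
  zero : g 0 = 0
  nonpos : ∀ u, 0 ≤ -g u
  le : ∀ u, -g u ≤ K * u ^ 2 / 2
  isCharFun : ∀ s : ℝ, 0 ≤ s → IsCharFun fun u => Complex.exp ((s * g u : ℝ) : ℂ)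
  -- For `u ≠ 0` the curve `e^{-s}u` never meets `0`, so differentiability of `L` at `0` is not
  -- required.
  deriv : ∀ u s, HasDerivAt (fun s => L (Real.exp (-s) * u)) (-g (Real.exp (-s) * u)) s
  tendsto : Tendsto L (𝓝 0) (𝓝 0)

namespace IsDrivingExponent

variable {g L : ℝ → ℝ} {K : ℝ}

theorem exists_process (h : IsDrivingExponent g L K) :
    ∃ P : Measure (ℝ≥0 → ℝ), IsProbabilityMeasure P ∧ HasExponent P (fun s ω => ω s) g := by
  have h1 := fun s : ℝ≥0 => h.isCharFun s s.2
  choose μ hμ using h1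
  have := fun s => (hμ s).1
  exact exists_hasExponent h.zero μ fun s u => (hμ s).2 u

/-- The background driving process and its random integrals. -/
theorem exists_integrals (h : IsDrivingExponent g L K) :
    ∃ (P : Measure (ℝ≥0 → ℝ)) (_ : IsProbabilityMeasure P)
      (_ : HasExponent P (fun s ω => ω s) g) (Z : ℝ≥0 → Lp ℝ 2 P) (X : Lp ℝ 2 P),
      (∀ T, IsRandomIntegral P (fun s => Real.exp (-s)) (fun s ω => ω s) T (Z T)) ∧
      Tendsto Z atTop (𝓝 X) ∧
      ∀ T u, charFun (P.map (Z T)) u =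
        Complex.exp ((L u - L (Real.exp (-(T : ℝ)) * u) : ℝ) : ℂ) := by
  obtain ⟨P, hP, hY⟩ := h.exists_process
  have hdist := hY.dist_toLp_le h.nonpos h.le
  choose Z hZ using fun T => exists_dist_le_of_mem_closure hdist (expTrunc_mem_closure T)
  obtain ⟨X, hX⟩ := exists_dist_le_of_mem_closure hdist expTail_mem_closure
  refine ⟨P, hP, hY, Z, X, fun T => hY.isRandomIntegral h.nonpos h.le (hZ T), ?_,
    fun T => hY.charFun_randomIntegral h.zero h.nonpos h.le (hZ T) h.deriv⟩
  rw [tendsto_iff_dist_tendsto_zero]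
  have h1 := (tendsto_iff_dist_tendsto_zero.1 tendsto_expTrunc).const_mul √K
  rw [mul_zero] at h1
  exact squeeze_zero (fun _ => dist_nonneg)
    (fun T => dist_le_of_mem_closure (expTrunc_mem_closure T) (hZ T) hX) h1

theorem charFun_limit (h : IsDrivingExponent g L K) {P : Measure (ℝ≥0 → ℝ)}
    [IsProbabilityMeasure P] {Z : ℝ≥0 → Lp ℝ 2 P} {X : Lp ℝ 2 P} (hZX : Tendsto Z atTop (𝓝 X))
    (hZ : ∀ T u, charFun (P.map (Z T)) u =
        Complex.exp ((L u - L (Real.exp (-(T : ℝ)) * u) : ℝ) : ℂ)) (u : ℝ) :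
    charFun (P.map X) u = Complex.exp (L u : ℂ) := by
  have h1 := ((continuous_charFun_map_Lp u).tendsto X).comp hZX
  refine tendsto_nhds_unique h1 ?_
  simp only [Function.comp_def, hZ]
  have h2 : Tendsto (fun T : ℝ≥0 => Real.exp (-(T : ℝ)) * u) atTop (𝓝 0) := by
    have : Tendsto (fun T : ℝ≥0 => Real.exp (-(T : ℝ))) atTop (𝓝 0) :=
      Real.tendsto_exp_neg_atTop_nhds_zero.comp (NNReal.tendsto_coe_atTop.2 tendsto_id)
    simpa using this.mul_const u
  have h3 : Tendsto (fun T : ℝ≥0 => L u - L (Real.exp (-(T : ℝ)) * u)) atTop (𝓝 (L u - 0)) :=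
    tendsto_const_nhds.sub (h.tendsto.comp h2)
  rw [sub_zero] at h3
  exact (Complex.continuous_exp.tendsto _).comp ((Complex.continuous_ofReal.tendsto _).comp h3)

theorem isBackgroundDrivingCharFun (h : IsDrivingExponent g L K) :
    IsBackgroundDrivingCharFun (fun u => Complex.exp (g u : ℂ)) fun u => Complex.exp (L u : ℂ) := by
  obtain ⟨P, hP, hY, Z, X, hint, hZX, hch⟩ := h.exists_integrals
  have hXm : Measurable X := (Lp.stronglyMeasurable X).measurable
  refine ⟨ℝ≥0 → ℝ, inferInstance, P, fun s ω => ω s, X, hP,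
    hY.isLevyProcess h.zero h.nonpos h.le, ⟨hXm, fun T => Z T, hint, ?_⟩,
    ⟨Measure.isProbabilityMeasure_map hXm.aemeasurable, fun u => h.charFun_limit hZX hch u⟩,
    ⟨Measure.isProbabilityMeasure_map (hY.measurable 1).aemeasurable, fun u => ?_⟩⟩
  · refine tendstoInMeasure_of_tendsto_eLpNorm (p := 2) (by norm_num)
      (fun T => Lp.aestronglyMeasurable _) (Lp.aestronglyMeasurable _) ?_
    have := tendsto_iff_edist_tendsto_0.1 hZX
    simpa only [Lp.edist_def] using this
  · rw [hY.charFun_map_apply h.zero]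
    simp

/-- With `T = -log c`, the factor `ρ_c` is the characteristic function of `∫_0^T e^{-s} dY(s)`. -/
theorem isSelfdecomposable (h : IsDrivingExponent g L K) :
    IsSelfdecomposable fun u => Complex.exp (L u : ℂ) := by
  obtain ⟨P, hP, hY, Z, X, hint, hZX, hch⟩ := h.exists_integrals
  have hm : ∀ f : Lp ℝ 2 P, IsProbabilityMeasure (P.map f) := fun f =>
    Measure.isProbabilityMeasure_map (Lp.stronglyMeasurable f).measurable.aemeasurable
  refine ⟨⟨P.map X, hm X, h.charFun_limit hZX hch⟩, fun c hc0 hc1 => ?_⟩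
  obtain ⟨T, hT⟩ : ∃ T : ℝ≥0, (T : ℝ) = -Real.log c :=
    ⟨⟨-Real.log c, by linarith [Real.log_neg hc0 hc1]⟩, rfl⟩
  refine ⟨_, ⟨P.map (Z T), hm _, hch T⟩, fun u => ?_⟩
  simp only [hT, neg_neg, Real.exp_log hc0]
  rw [← Complex.exp_add]
  congr 1
  push_cast
  ring

theorem isInfinitelyDivisible (h : IsDrivingExponent g L K) :
    IsInfinitelyDivisible fun u => Complex.exp (g u : ℂ) := by
  refine ⟨by simpa using h.isCharFun 1 zero_le_one, fun n hn => ⟨_, h.isCharFun (1 / n)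
    (by positivity), fun u => ?_⟩⟩
  simp only
  rw [← Complex.exp_nat_mul]
  congr 1
  have : (n : ℂ) ≠ 0 := by exact_mod_cast (by omega : n ≠ 0)
  push_cast
  field_simp

/-- The quadratic bound on `-g` even gives a finite second moment, and `log(1 + |x|) ≤ |x| ≤ 1 +
x²`. -/
theorem exists_hasFiniteLogMoment (h : IsDrivingExponent g L K) :
    ∃ μ : Measure ℝ, HasCharFun μ (fun u => Complex.exp (g u : ℂ)) ∧ HasFiniteLogMoment μ := by
  obtain ⟨μ, hμ, hch⟩ := h.isCharFun 1 zero_le_one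
  simp only [one_mul] at hch
  refine ⟨μ, ⟨hμ, hch⟩, ?_⟩
  have hsq : ∫⁻ x, ENNReal.ofReal (x ^ 2) ∂μ ≤ ENNReal.ofReal K := by
    refine lintegral_sq_le_of_charFun fun u => ?_
    rw [hch u, Complex.exp_ofReal_re]
    have h1 := h.le u
    have h2 := Real.add_one_le_exp (g u)
    linarith
  have hi : Integrable (fun x : ℝ => x ^ 2) μ :=
    ⟨by fun_prop, (hasFiniteIntegral_iff_ofReal (ae_of_all _ fun x => sq_nonneg x)).2
      (hsq.trans_lt ENNReal.ofReal_lt_top)⟩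
  refine ((integrable_const (1 : ℝ)).add hi).mono' (Measurable.aestronglyMeasurable (by fun_prop))
    (ae_of_all _ fun x => ?_)
  have h0 := abs_nonneg x
  have h1 : 0 ≤ Real.log (1 + |x|) := Real.log_nonneg (by linarith)
  have h2 : Real.log (1 + |x|) ≤ |x| := by
    linarith [Real.log_le_sub_one_of_pos (show 0 < 1 + |x| by linarith)]
  rw [Real.norm_of_nonneg h1, Pi.add_apply]
  nlinarith [sq_abs x, sq_nonneg (|x| - 1)]

end IsDrivingExponent

/-! ### Closure properties of characteristic functions -/

theorem isCharFun_mul {φ ψ : ℝ → ℂ} (hφ : IsCharFun φ) (hψ : IsCharFun ψ) :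
    IsCharFun fun t => φ t * ψ t := by
  obtain ⟨μ, hμ, h1⟩ := hφ
  obtain ⟨ν, hν, h2⟩ := hψ
  exact ⟨μ ∗ ν, inferInstance, fun t => by rw [charFun_conv, h1, h2]⟩

theorem isCharFun_pow {φ : ℝ → ℂ} (hφ : IsCharFun φ) (n : ℕ) : IsCharFun fun t => φ t ^ n := by
  induction n with
  | zero => exact ⟨Measure.dirac 0, inferInstance, fun t => by simp⟩
  | succ n ih => simpa only [pow_succ] using isCharFun_mul ih hφ

/-- **Lévy's continuity theorem**. -/
theorem isCharFun_of_tendsto {φ : ℕ → ℝ → ℂ} {ψ : ℝ → ℂ} (hφ : ∀ n, IsCharFun (φ n))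
    (hψ : ContinuousAt ψ 0) (h : ∀ t, Tendsto (fun n => φ n t) atTop (𝓝 (ψ t))) :
    IsCharFun ψ := by
  choose μ hμ hch using hφ
  -- Continuity of the limit at `0` prevents mass from escaping; Prokhorov's theorem then supplies a
  -- limit law along an ultrafilter.
  have htight := isTightMeasureSet_of_tendsto_charFun (μ := μ) hψ fun t => by
    simpa only [hch] using h t
  let ν : ℕ → ProbabilityMeasure ℝ := fun n => ⟨μ n, hμ n⟩
  have hcomp : IsCompact (closure (Set.range ν)) := by
    refine isCompact_closure_of_isTightMeasureSet ?_
    convert! htight using 1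
    ext m
    exact ⟨by rintro ⟨_, ⟨n, rfl⟩, rfl⟩; exact ⟨n, rfl⟩,
      by rintro ⟨n, rfl⟩; exact ⟨ν n, ⟨n, rfl⟩, rfl⟩⟩
  let U : Ultrafilter ℕ := hyperfilter ℕ
  obtain ⟨ν', -, hν'⟩ := hcomp.ultrafilter_le_nhds (U.map ν) (by
    rw [le_principal_iff, Ultrafilter.coe_map, mem_map]
    exact Filter.Eventually.of_forall fun n => subset_closure ⟨n, rfl⟩)
  have hν'' : Tendsto ν U (𝓝 ν') := hν'
  rw [ProbabilityMeasure.tendsto_iff_forall_integral_rclike_tendsto ℂ] at hν''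
  refine ⟨ν', inferInstance, fun t => ?_⟩
  have h1 := hν'' (BoundedContinuousFunction.innerProbChar t)
  simp_rw [← charFun_eq_integral_innerProbChar] at h1
  refine tendsto_nhds_unique h1 ?_
  have h2 : ∀ n, charFun (ν n : Measure ℝ) t = φ n t := fun n => hch n t
  simp_rw [h2]
  exact (h t).mono_left Nat.hyperfilter_le_atTop

/-- Compound Poisson laws. -/
theorem isCharFun_exp_charFun_sub (M : Measure ℝ) [IsFiniteMeasure M] :
    IsCharFun fun t => Complex.exp (charFun M t - M.real Set.univ) := by
  -- The target is the limit of `(1 + (charFun M t - m)/k)^k` with `k = n + N + 1`. Having `N` above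
  -- the mass `m` makes `(1 - m/k) δ₀ + M/k` a probability measure for every `n`.
  obtain ⟨N, hN⟩ := exists_nat_gt (M.real Set.univ)
  set m := M.real Set.univ
  have hm0 : 0 ≤ m := measureReal_nonneg
  refine isCharFun_of_tendsto (φ := fun n t =>
    (1 + (charFun M t - m) / ((n + N + 1 : ℕ) : ℂ)) ^ (n + N + 1)) (fun n => ?_) ?_ fun t => ?_
  · refine isCharFun_pow ?_ _
    set k : ℝ := ((n + N + 1 : ℕ) : ℝ)
    have hk : 0 < k := by positivity
    have hmk : m ≤ k := by
      simp only [k]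
      push_cast
      have : (0 : ℝ) ≤ n := Nat.cast_nonneg n
      linarith
    have hmk' : m / k ≤ 1 := (div_le_one hk).2 hmk
    set a : ℝ≥0 := Real.toNNReal (1 - m / k)
    set b : ℝ≥0 := Real.toNNReal (1 / k)
    have ha : (a : ℝ) = 1 - m / k := Real.coe_toNNReal _ (by linarith)
    have hb : (b : ℝ) = 1 / k := Real.coe_toNNReal _ (by positivity)
    have hexp : ∀ (ν : Measure ℝ) [IsFiniteMeasure ν] (t : ℝ),
        Integrable (fun x : ℝ => Complex.exp (t * x * Complex.I)) ν := by
      intro ν _ t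
      refine Integrable.of_bound (C := 1) (by fun_prop) (ae_of_all _ fun x => ?_)
      rw [← Complex.ofReal_mul, Complex.norm_exp_ofReal_mul_I]
    refine ⟨a • Measure.dirac 0 + b • M, ⟨?_⟩, fun t => ?_⟩
    · rw [← ENNReal.toReal_eq_one_iff]
      change (a • Measure.dirac 0 + b • M).real Set.univ = 1
      rw [measureReal_add_apply, measureReal_nnreal_smul_apply, measureReal_nnreal_smul_apply,
        probReal_univ, ha, hb]
      change (1 - m / k) * 1 + 1 / k * m = 1
      ring
    · have hkc : ((n + N + 1 : ℕ) : ℂ) = (k : ℂ) := by simp [k]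
      rw [charFun_apply_real, integral_add_measure (hexp _ _) (hexp _ _),
        integral_smul_nnreal_measure, integral_smul_nnreal_measure, ← charFun_apply_real,
        ← charFun_apply_real, charFun_dirac, NNReal.smul_def, NNReal.smul_def, ha, hb, hkc]
      simp only [inner_zero_left, Complex.ofReal_zero, zero_mul, Complex.exp_zero,
        Complex.real_smul]
      push_cast
      ring
  · exact Continuous.continuousAt (by fun_prop)
  · have h1 := Complex.tendsto_one_add_div_pow_exp (charFun M t - m)
    have h2 : Tendsto (fun n : ℕ => n + N + 1) atTop atTop :=
      tendsto_atTop_mono (fun n => by dsimp only [id]; omega) tendsto_id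
    exact h1.comp h2

/-! ### Symmetric Lévy densities with finite second moment -/

theorem integral_measureOfDensity {h : ℝ → ℝ} (hm : Measurable h) (h0 : ∀ x, 0 ≤ h x)
    (F : ℝ → ℂ) : ∫ x, F x ∂(measureOfDensity h) = ∫ x, h x * F x := by
  rw [measureOfDensity, integral_withDensity_eq_integral_toReal_smul (by fun_prop)
    (ae_of_all _ fun x => ENNReal.ofReal_lt_top)]
  congr 1
  ext x
  rw [ENNReal.toReal_ofReal (h0 x), Complex.real_smul]

/-- The integral of a function is the integral of its even part. -/
theorem integral_eq_integral_even_part {F : ℝ → ℂ} {G : ℝ → ℝ} (hF : Integrable F)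
    (h : ∀ x, F x + F (-x) = 2 * G x) : ∫ x, F x = ((∫ x, G x : ℝ) : ℂ) := by
  have h1 : ∫ x, F (-x) = ∫ x, F x := integral_neg_eq_self F volume
  have h2 : ∫ x, (F x + F (-x)) = 2 * ∫ x, F x := by
    rw [integral_add hF hF.comp_neg, h1, two_mul]
  simp_rw [h] at h2
  rw [integral_const_mul, integral_complex_ofReal] at h2
  exact (mul_left_cancel₀ two_ne_zero h2).symm

theorem norm_exp_sub_one_sub_le (y : ℝ) :
    ‖Complex.exp (Complex.I * y) - 1 - Complex.I * y‖ ≤ 2 * y ^ 2 := by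
  have hn : ‖Complex.I * (y : ℂ)‖ = |y| := by simp
  rcases le_or_gt |y| 1 with hy | hy
  · have := Complex.norm_exp_sub_one_sub_id_le (x := Complex.I * y) (by rwa [hn])
    rw [hn, sq_abs] at this
    nlinarith [sq_nonneg y]
  · refine (norm_sub_le _ _).trans ?_
    have := Real.norm_exp_I_mul_ofReal_sub_one_le (x := y)
    rw [Real.norm_eq_abs] at this
    rw [hn, ← sq_abs y]
    nlinarith

/-- A symmetric Lévy density with finite second moment. -/
structure IsLevyDensity (h : ℝ → ℝ) : Prop where
  measurable : Measurable h
  nonneg : ∀ x, 0 ≤ h x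
  even : ∀ x, h (-x) = h x
  integrable : Integrable fun x => x ^ 2 * h x

namespace IsLevyDensity

variable {h : ℝ → ℝ} (hh : IsLevyDensity h)

include hh

theorem one_sub_cos_mul_le (t x : ℝ) : (1 - Real.cos (t * x)) * h x ≤ t ^ 2 / 2 * (x ^ 2 * h x) := by
  have := Real.one_sub_sq_div_two_le_cos (x := t * x)
  calc (1 - Real.cos (t * x)) * h x ≤ ((t * x) ^ 2 / 2) * h x :=
        mul_le_mul_of_nonneg_right (by linarith) (hh.nonneg x)
    _ = _ := by ring

theorem one_sub_cos_mul_nonneg (t x : ℝ) : 0 ≤ (1 - Real.cos (t * x)) * h x :=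
  mul_nonneg (by linarith [Real.cos_le_one (t * x)]) (hh.nonneg x)

theorem integrable_one_sub_cos (t : ℝ) : Integrable fun x => (1 - Real.cos (t * x)) * h x := by
  have := hh.measurable
  refine (hh.integrable.const_mul (t ^ 2 / 2)).mono' (Measurable.aestronglyMeasurable (by fun_prop))
    (ae_of_all _ fun x => ?_)
  rw [Real.norm_of_nonneg (hh.one_sub_cos_mul_nonneg t x)]
  exact hh.one_sub_cos_mul_le t x

theorem integral_one_sub_cos_nonneg (t : ℝ) : 0 ≤ ∫ x, (1 - Real.cos (t * x)) * h x :=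
  integral_nonneg fun x => hh.one_sub_cos_mul_nonneg t x

theorem integral_one_sub_cos_le (t : ℝ) :
    ∫ x, (1 - Real.cos (t * x)) * h x ≤ (∫ x, x ^ 2 * h x) * t ^ 2 / 2 := by
  have := integral_mono (hh.integrable_one_sub_cos t) (hh.integrable.const_mul (t ^ 2 / 2))
    fun x => hh.one_sub_cos_mul_le t x
  rw [integral_const_mul] at this
  linarith

theorem continuousAt_integral_one_sub_cos :
    ContinuousAt (fun t => ∫ x, (1 - Real.cos (t * x)) * h x) 0 := by
  have h0 : ∫ x, (1 - Real.cos (0 * x)) * h x = 0 := by simp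
  rw [ContinuousAt, h0]
  have hlim : Tendsto (fun t : ℝ => (∫ x, x ^ 2 * h x) * t ^ 2 / 2) (𝓝 0) (𝓝 0) := by
    have : Continuous fun t : ℝ => (∫ x, x ^ 2 * h x) * t ^ 2 / 2 := by fun_prop
    simpa using this.tendsto 0
  exact squeeze_zero hh.integral_one_sub_cos_nonneg hh.integral_one_sub_cos_le hlim

/-- A finite Lévy measure is the compound Poisson case; evenness of `h` removes the sine part. -/
theorem isCharFun_of_integrable (hi : Integrable h) :
    IsCharFun fun t => Complex.exp ((-∫ x, (1 - Real.cos (t * x)) * h x : ℝ) : ℂ) := by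
  have hfin : IsFiniteMeasure (measureOfDensity h) :=
    isFiniteMeasure_withDensity_ofReal hi.2
  have hcomp := isCharFun_exp_charFun_sub (measureOfDensity h)
  convert! hcomp using 3 with t
  have h1 : charFun (measureOfDensity h) t - ((measureOfDensity h).real Set.univ : ℂ) =
      ∫ x, (h x * (Complex.exp (t * x * Complex.I) - 1) : ℂ) := by
    have e : ∫ x, (1 : ℂ) ∂(measureOfDensity h) = ((measureOfDensity h).real Set.univ : ℂ) := by
      rw [integral_const, Complex.real_smul, mul_one]
    rw [charFun_apply_real, ← e, ← integral_sub, integral_measureOfDensity hh.measurable hh.nonneg]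
    · refine Integrable.of_bound (C := 1) (by fun_prop) (ae_of_all _ fun x => ?_)
      rw [← Complex.ofReal_mul, Complex.norm_exp_ofReal_mul_I]
    · exact integrable_const _
  rw [h1, integral_eq_integral_even_part (G := fun x => -((1 - Real.cos (t * x)) * h x)),
    integral_neg]
  · refine hi.ofReal.mul_bdd (c := 2) (Measurable.aestronglyMeasurable (by fun_prop))
      (ae_of_all _ fun x => ?_)
    refine (norm_sub_le _ _).trans ?_
    rw [← Complex.ofReal_mul, Complex.norm_exp_ofReal_mul_I]
    norm_num
  · intro x
    rw [hh.even]
    push_cast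
    rw [Complex.cos]
    ring_nf

/-- Existence of the infinitely divisible law with Lévy density `h`. -/
theorem isCharFun :
    IsCharFun fun t => Complex.exp ((-∫ x, (1 - Real.cos (t * x)) * h x : ℝ) : ℂ) := by
  -- Away from `|x| < 1/(n+1)` one has `h ≤ (n+1)² x² h`, so the truncated density is integrable.
  set A : ℕ → Set ℝ := fun n => {x | 1 / ((n : ℝ) + 1) ≤ |x|}
  have hA : ∀ n, MeasurableSet (A n) := fun n => measurableSet_le (by fun_prop) (by fun_prop)
  set k : ℕ → ℝ → ℝ := fun n => (A n).indicator h
  have hkm : ∀ n, Measurable (k n) := fun n => hh.measurable.indicator (hA n)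
  have hk0 : ∀ n x, 0 ≤ k n x := fun n x => Set.indicator_nonneg (fun y _ => hh.nonneg y) x
  have hkle : ∀ n x, k n x ≤ h x := fun n x => Set.indicator_le_self' (fun y _ => hh.nonneg y) x
  have hkint : ∀ n, Integrable (k n) := by
    intro n
    refine (hh.integrable.const_mul (((n : ℝ) + 1) ^ 2)).mono' (hkm n).aestronglyMeasurable
      (ae_of_all _ fun x => ?_)
    rw [Real.norm_of_nonneg (hk0 n x)]
    by_cases hx : x ∈ A n
    · simp only [k, Set.indicator_of_mem hx]
      have hx' : 1 / ((n : ℝ) + 1) ≤ |x| := hx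
      have h1 : 1 ≤ ((n : ℝ) + 1) * |x| := by
        rw [div_le_iff₀ (by positivity)] at hx'
        linarith
      have h2 : 1 ≤ ((n : ℝ) + 1) ^ 2 * x ^ 2 := by
        rw [← sq_abs x, ← mul_pow]
        exact one_le_pow₀ h1
      nlinarith [hh.nonneg x]
    · simp only [k, Set.indicator_of_notMem hx]
      have := hh.nonneg x
      positivity
  have hkL : ∀ n, IsLevyDensity (k n) := by
    intro n
    refine ⟨hkm n, hk0 n, fun x => ?_, ?_⟩
    · have hiff : -x ∈ A n ↔ x ∈ A n := by simp [A]
      by_cases hx : x ∈ A n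
      · simp only [k, Set.indicator_of_mem hx, Set.indicator_of_mem (hiff.2 hx), hh.even]
      · simp only [k, Set.indicator_of_notMem hx, Set.indicator_of_notMem (mt hiff.1 hx)]
    · have := hkm n
      refine hh.integrable.mono' (Measurable.aestronglyMeasurable (by fun_prop))
        (ae_of_all _ fun x => ?_)
      rw [Real.norm_of_nonneg (mul_nonneg (sq_nonneg x) (hk0 n x))]
      exact mul_le_mul_of_nonneg_left (hkle n x) (sq_nonneg x)
  refine isCharFun_of_tendsto (fun n => (hkL n).isCharFun_of_integrable (hkint n)) ?_ fun t => ?_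
  · exact (Complex.continuous_exp.comp Complex.continuous_ofReal).continuousAt.comp
      hh.continuousAt_integral_one_sub_cos.neg
  · refine ((Complex.continuous_exp.comp Complex.continuous_ofReal).tendsto _).comp
      (Tendsto.neg ?_)
    refine tendsto_integral_of_dominated_convergence (fun x => (1 - Real.cos (t * x)) * h x)
      (fun n => ?_) (hh.integrable_one_sub_cos t) (fun n => ae_of_all _ fun x => ?_)
      (ae_of_all _ fun x => ?_)
    · have := hkm n
      exact Measurable.aestronglyMeasurable (by fun_prop)
    · rw [Real.norm_of_nonneg ((hkL n).one_sub_cos_mul_nonneg t x)]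
      exact mul_le_mul_of_nonneg_left (hkle n x) (by linarith [Real.cos_le_one (t * x)])
    · rcases eq_or_ne x 0 with rfl | hx
      · simp
      · refine tendsto_const_nhds.congr' ?_
        have h1 := tendsto_one_div_add_atTop_nhds_zero_nat (𝕜 := ℝ)
        filter_upwards [h1.eventually (Iic_mem_nhds (abs_pos.2 hx))] with n hn
        simp only [k]
        rw [Set.indicator_of_mem (show x ∈ A n from hn)]

theorem const_mul {s : ℝ} (hs : 0 ≤ s) : IsLevyDensity fun x => s * h x where
  measurable := hh.measurable.const_mul s
  nonneg x := mul_nonneg hs (hh.nonneg x)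
  even x := by rw [hh.even]
  integrable := by
    refine (hh.integrable.const_mul s).congr (ae_of_all _ fun x => ?_)
    ring

theorem isLevyMeasure : IsLevyMeasure (measureOfDensity h) := by
  refine ⟨withDensity_absolutelyContinuous _ _ (by simp), ?_⟩
  have hm := hh.measurable
  rw [measureOfDensity, lintegral_withDensity_eq_lintegral_mul _ (by fun_prop) (by fun_prop)]
  refine lt_of_le_of_lt (lintegral_mono fun x => ?_) hh.integrable.lintegral_lt_top
  rw [Pi.mul_apply, ← ENNReal.ofReal_mul (hh.nonneg x), mul_comm]
  exact ENNReal.ofReal_le_ofReal (mul_le_mul_of_nonneg_right (min_le_right _ _) (hh.nonneg x))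

/-- There is neither drift nor Gaussian part: the sine and the centring term are odd and integrate
to `0` against the even `h`. -/
theorem isLevyMeasureOf {ψ : ℝ → ℂ}
    (hψ : ∀ t, ψ t = Complex.exp ((-∫ x, (1 - Real.cos (t * x)) * h x : ℝ) : ℂ)) :
    IsLevyMeasureOf (measureOfDensity h) ψ := by
  refine ⟨hh.isLevyMeasure, 0, 0, le_rfl, fun t => ?_⟩
  rw [hψ, integral_measureOfDensity hh.measurable hh.nonneg,
    integral_eq_integral_even_part (G := fun x => -((1 - Real.cos (t * x)) * h x)), integral_neg]
  · simp
  · have hm := hh.measurable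
    refine (hh.integrable.const_mul (2 * t ^ 2 + |t|)).mono'
      (Measurable.aestronglyMeasurable (by fun_prop)) (ae_of_all _ fun x => ?_)
    have hx : (1 + (x : ℂ) ^ 2) ≠ 0 := by
      have : (1 + x ^ 2 : ℝ) ≠ 0 := by positivity
      exact_mod_cast this
    -- Exchanging the centring `x/(1+x²)` for `x` leaves the remainder `x³/(1+x²)`; both pieces are
    -- then `O(x²)`, hence integrable against `h`.
    have e : Complex.exp (Complex.I * t * x) - 1 - Complex.I * t * x / (1 + x ^ 2) =
        (Complex.exp (Complex.I * (t * x : ℝ)) - 1 - Complex.I * (t * x : ℝ)) +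
          Complex.I * ((t * (x ^ 3 / (1 + x ^ 2)) : ℝ) : ℂ) := by
      push_cast
      rw [mul_assoc]
      field_simp
      ring
    have h1 := norm_exp_sub_one_sub_le (t * x)
    have h2 : |x ^ 3 / (1 + x ^ 2)| ≤ x ^ 2 := by
      rw [abs_div, abs_of_pos (show 0 < 1 + x ^ 2 by positivity), div_le_iff₀ (by positivity),
        abs_pow, ← sq_abs x]
      have := abs_nonneg x
      nlinarith [sq_nonneg (|x| - 1), sq_nonneg |x|, mul_nonneg (sq_nonneg |x|) (sq_nonneg (|x| - 1)),
        mul_nonneg (sq_nonneg |x|) (sq_nonneg |x|)]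
    have h3 : ‖Complex.exp (Complex.I * t * x) - 1 - Complex.I * t * x / (1 + x ^ 2)‖ ≤
        (2 * t ^ 2 + |t|) * x ^ 2 := by
      rw [e]
      refine (norm_add_le _ _).trans ?_
      rw [norm_mul, Complex.norm_I, one_mul, Complex.norm_real, Real.norm_eq_abs, abs_mul]
      have := mul_le_mul_of_nonneg_left h2 (abs_nonneg t)
      nlinarith
    rw [norm_mul, Complex.norm_real, Real.norm_of_nonneg (hh.nonneg x)]
    have := mul_le_mul_of_nonneg_left h3 (hh.nonneg x)
    linarith
  · intro x
    rw [hh.even]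
    push_cast
    rw [Complex.cos]
    ring_nf

theorem isDrivingExponent {g φ : ℝ → ℝ} (hg : ∀ t, g t = -∫ x, (1 - Real.cos (t * x)) * h x)
    (hφ0 : φ 0 = 1) (hφ : ContinuousAt φ 0)
    (hd : ∀ t, t ≠ 0 → HasDerivAt (fun s => Real.log (φ s)) (g t / t) t) :
    IsDrivingExponent g (fun t => Real.log (φ t)) (∫ x, x ^ 2 * h x) where
  zero := by simp [hg]
  nonpos u := by simpa [hg] using hh.integral_one_sub_cos_nonneg u
  le u := by simpa [hg] using hh.integral_one_sub_cos_le u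
  isCharFun s hs := by
    have := (hh.const_mul hs).isCharFun
    convert! this using 4 with t
    rw [hg, mul_neg, ← integral_const_mul]
    congr 2
    ext x
    ring
  deriv u s := by
    rcases eq_or_ne u 0 with rfl | hu
    · simpa [hg] using hasDerivAt_const s (Real.log (φ 0))
    · have hne : Real.exp (-s) * u ≠ 0 := mul_ne_zero (Real.exp_pos _).ne' hu
      have h1 : HasDerivAt (fun s => Real.exp (-s) * u) (Real.exp (-s) * -1 * u) s :=
        ((hasDerivAt_neg s).exp).mul_const u
      have h2 := (hd _ hne).comp s h1
      convert! h2 using 1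
      field_simp
  tendsto := by
    have := (hφ.log (by simp [hφ0])).tendsto
    simpa [hφ0] using this

end IsLevyDensity

/-! ### Hyperbolic inequalities -/

theorem sq_le_sinh_sq (y : ℝ) : y ^ 2 ≤ Real.sinh y ^ 2 := by
  rw [← sq_abs y, ← sq_abs (Real.sinh y), Real.abs_sinh]
  exact pow_le_pow_left₀ (abs_nonneg y) (Real.self_le_sinh_iff.2 (abs_nonneg y)) 2

theorem one_add_sq_le_cosh_sq (y : ℝ) : 1 + y ^ 2 ≤ Real.cosh y ^ 2 := by
  rw [Real.cosh_sq]
  linarith [sq_le_sinh_sq y]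

theorem sinh_eq_two_mul_half (y : ℝ) :
    Real.sinh y = 2 * Real.sinh (y / 2) * Real.cosh (y / 2) := by
  rw [← Real.sinh_two_mul, mul_div_cancel₀ y two_ne_zero]

/-- The bounds for `sinh` and `cosh` at `y/2` multiply by the duplication formula. The extra factor
`1 + y²/4` provides the decay of `x² densS x` at infinity. -/
theorem sq_mul_le_sinh_sq (y : ℝ) : y ^ 2 * (1 + y ^ 2 / 4) ≤ Real.sinh y ^ 2 := by
  have h1 := sq_le_sinh_sq (y / 2)
  have h2 := one_add_sq_le_cosh_sq (y / 2)
  have h3 := mul_le_mul h1 h2 (by positivity) (by positivity)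
  rw [sinh_eq_two_mul_half]
  nlinarith

/-! ### The density of `N_S` -/

theorem sq_mul_densS_le (x : ℝ) : x ^ 2 * densS x ≤ 2 * (1 + x ^ 2)⁻¹ := by
  rcases eq_or_ne x 0 with rfl | hx
  · simp
  have hpi := Real.pi_gt_three
  have hpi2 : 9 ≤ Real.pi ^ 2 := by nlinarith
  have hs : Real.sinh (Real.pi * x / 2) ≠ 0 := by
    rw [Ne, Real.sinh_eq_zero]
    positivity
  have hs2 : 0 < Real.sinh (Real.pi * x / 2) ^ 2 := by positivity
  have h1 := sq_mul_le_sinh_sq (Real.pi * x / 2)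
  -- The previous bound reads `8 sinh² ≥ 2π²x² + π⁴x⁴/8`, and `π² ≥ 9` makes the quartic coefficient
  -- at least `π²`.
  have h2 : Real.pi ^ 2 * (x ^ 2 * (1 + x ^ 2)) ≤ 8 * Real.sinh (Real.pi * x / 2) ^ 2 := by
    have : 0 ≤ Real.pi ^ 2 * x ^ 2 := by positivity
    have h3 : 9 * (Real.pi ^ 2 * x ^ 2 * x ^ 2) ≤ Real.pi ^ 2 * (Real.pi ^ 2 * x ^ 2 * x ^ 2) :=
      mul_le_mul_of_nonneg_right hpi2 (by positivity)
    nlinarith [mul_nonneg this (sq_nonneg x)]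
  have h4 : Real.pi * (x ^ 2 * (1 + x ^ 2)) ≤ 8 * Real.sinh (Real.pi * x / 2) ^ 2 := by
    refine le_trans (mul_le_mul_of_nonneg_right ?_ (by positivity)) h2
    nlinarith
  have e : x ^ 2 * densS x = Real.pi * x ^ 2 / (4 * Real.sinh (Real.pi * x / 2) ^ 2) := by
    rw [densS]
    field_simp
  rw [e, ← div_eq_mul_inv, div_le_div_iff₀ (by positivity) (by positivity)]
  linarith

theorem isLevyDensity_densS : IsLevyDensity densS where
  measurable := by unfold densS; fun_prop
  nonneg x := by unfold densS; positivity
  even x := by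
    rw [densS, densS, mul_neg, neg_div, Real.sinh_neg, neg_sq]
  integrable := by
    refine (integrable_inv_one_add_sq.const_mul 2).mono'
      (Measurable.aestronglyMeasurable (by unfold densS; fun_prop)) (ae_of_all _ fun x => ?_)
    rw [Real.norm_of_nonneg (by unfold densS; positivity)]
    exact sq_mul_densS_le x

/-! ### Integrals against exponential densities -/

/-- The primitive is the real part of `-e^{-ax} + a e^{-(a-it)x}/(a-it)`; it vanishes at infinity
and equals `-t²/(a²+t²)` at `0`. -/
theorem hasDerivAt_one_sub_cos_mul_exp {a : ℝ} (ha : 0 < a) (t x : ℝ) :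
    HasDerivAt (fun x => -Real.exp (-a * x) +
      a * Real.exp (-a * x) * (a * Real.cos (t * x) - t * Real.sin (t * x)) / (a ^ 2 + t ^ 2))
      ((1 - Real.cos (t * x)) * (a * Real.exp (-a * x))) x := by
  have hne : a ^ 2 + t ^ 2 ≠ 0 := by positivity
  have h1 : HasDerivAt (fun x => Real.exp (-a * x)) (Real.exp (-a * x) * (-a)) x := by
    simpa using ((hasDerivAt_id x).const_mul (-a)).exp
  have hl : HasDerivAt (fun x => t * x) t x := by simpa using (hasDerivAt_id x).const_mul t
  have h2 := (hl.cos.const_mul a).sub (hl.sin.const_mul t)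
  convert! h1.neg.add (((h1.const_mul a).mul h2).div_const (a ^ 2 + t ^ 2)) using 1
  simp only [Pi.sub_apply]
  field_simp
  ring

theorem tendsto_one_sub_cos_mul_exp {a : ℝ} (ha : 0 < a) (t : ℝ) :
    Tendsto (fun x => -Real.exp (-a * x) +
      a * Real.exp (-a * x) * (a * Real.cos (t * x) - t * Real.sin (t * x)) / (a ^ 2 + t ^ 2))
      atTop (𝓝 0) := by
  have h1 : Tendsto (fun x => Real.exp (-a * x)) atTop (𝓝 0) :=
    Real.tendsto_exp_atBot.comp (tendsto_id.const_mul_atTop_of_neg (by linarith))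
  have h2 : Tendsto (fun x => Real.exp (-a * x) *
      (a * Real.cos (t * x) - t * Real.sin (t * x))) atTop (𝓝 0) := by
    refine bdd_le_mul_tendsto_zero' (a + |t|) (Eventually.of_forall fun x => ?_) h1 |>.congr
      fun x => mul_comm _ _
    refine (abs_sub _ _).trans ?_
    rw [abs_mul, abs_mul, abs_of_pos ha]
    refine add_le_add ?_ ?_
    · simpa using mul_le_mul_of_nonneg_left (Real.abs_cos_le_one (t * x)) ha.le
    · simpa using mul_le_mul_of_nonneg_left (Real.abs_sin_le_one (t * x)) (abs_nonneg t)
  have h3 := h1.neg.add (h2.const_mul (a / (a ^ 2 + t ^ 2)))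
  simp only [neg_zero, mul_zero, add_zero] at h3
  refine h3.congr fun x => ?_
  ring

theorem one_sub_cos_mul_exp_nonneg {a : ℝ} (ha : 0 < a) (t x : ℝ) :
    0 ≤ (1 - Real.cos (t * x)) * (a * Real.exp (-a * x)) :=
  mul_nonneg (by linarith [Real.cos_le_one (t * x)]) (by positivity)

theorem integrableOn_one_sub_cos_mul_exp {a : ℝ} (ha : 0 < a) (t : ℝ) :
    IntegrableOn (fun x => (1 - Real.cos (t * x)) * (a * Real.exp (-a * x))) (Set.Ioi 0) :=
  integrableOn_Ioi_deriv_of_nonneg' (fun x _ => hasDerivAt_one_sub_cos_mul_exp ha t x)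
    (fun x _ => one_sub_cos_mul_exp_nonneg ha t x) (tendsto_one_sub_cos_mul_exp ha t)

theorem integral_one_sub_cos_mul_exp {a : ℝ} (ha : 0 < a) (t : ℝ) :
    ∫ x in Set.Ioi 0, (1 - Real.cos (t * x)) * (a * Real.exp (-a * x)) =
      t ^ 2 / (t ^ 2 + a ^ 2) := by
  rw [integral_Ioi_of_hasDerivAt_of_nonneg' (fun x _ => hasDerivAt_one_sub_cos_mul_exp ha t x)
    (fun x _ => one_sub_cos_mul_exp_nonneg ha t x) (tendsto_one_sub_cos_mul_exp ha t)]
  have hne : a ^ 2 + t ^ 2 ≠ 0 := by positivity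
  have hne' : t ^ 2 + a ^ 2 ≠ 0 := by positivity
  simp only [mul_zero, Real.exp_zero, Real.cos_zero, Real.sin_zero]
  field_simp
  ring

/-! ### Expansion in partial fractions -/

/-- With `q = e^{-πx}`, the sum `∑ n qⁿ = q/(1-q)²` equals `1/(4 sinh²(πx/2))`. The index is shifted
because the term `n = 0` vanishes. -/
theorem hasSum_densS {x : ℝ} (hx : 0 < x) :
    HasSum (fun n : ℕ => Real.pi * (n + 1) * Real.exp (-(Real.pi * (n + 1)) * x)) (densS x) := by
  set q := Real.exp (-(Real.pi * x)) with hq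
  have hpx : 0 < Real.pi * x := by positivity
  have hq1 : q < 1 := by simpa [hq] using hpx
  have hq0 : 0 < q := Real.exp_pos _
  have h1 : HasSum (fun n : ℕ => (n : ℝ) * q ^ n) (q / (1 - q) ^ 2) :=
    hasSum_coe_mul_geometric_of_norm_lt_one (by rwa [Real.norm_of_nonneg hq0.le])
  have h2 := ((hasSum_nat_add_iff' 1).2 h1).mul_left Real.pi
  convert! h2 using 1
  · ext n
    rw [hq, ← Real.exp_nat_mul]
    push_cast
    rw [mul_assoc]
    congr 3
    ring
  · set p := Real.exp (Real.pi * x / 2) with hp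
    have hp1 : 1 < p := by
      rw [hp, Real.one_lt_exp_iff]
      positivity
    have hqp : q = (p ^ 2)⁻¹ := by
      rw [hq, hp, ← Real.exp_nat_mul, ← Real.exp_neg]
      congr 1
      push_cast
      ring
    have hp2 : p ^ 2 - 1 ≠ 0 := by nlinarith
    simp only [Finset.range_one, Finset.sum_singleton, Nat.cast_zero, zero_mul, sub_zero]
    rw [densS, Real.sinh_eq, Real.exp_neg, ← hp, hqp]
    have hp0 : p ≠ 0 := by positivity
    have e1 : (p - p⁻¹) / 2 = (p ^ 2 - 1) / (2 * p) := by field_simp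
    have e2 : 1 - (p ^ 2)⁻¹ = (p ^ 2 - 1) / p ^ 2 := by field_simp
    rw [e1, e2]
    field_simp
    norm_num

theorem summable_div_sq_add (t : ℝ) :
    Summable fun n : ℕ => t ^ 2 / (t ^ 2 + (Real.pi * (n + 1)) ^ 2) := by
  have h1 : Summable fun n : ℕ => t ^ 2 / ((n : ℝ) + 1) ^ 2 := by
    have := ((summable_nat_add_iff 1).2 (Real.summable_one_div_nat_pow.2 one_lt_two)).mul_left
      (t ^ 2)
    refine this.congr fun n => ?_
    push_cast
    ring
  refine h1.of_nonneg_of_le (fun n => by positivity) fun n => ?_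
  have hpi := Real.pi_gt_three
  refine div_le_div_of_nonneg_left (sq_nonneg t) (by positivity) ?_
  have : ((n : ℝ) + 1) ^ 2 ≤ (Real.pi * (n + 1)) ^ 2 := by
    refine pow_le_pow_left₀ (by positivity) ?_ 2
    have : (0 : ℝ) ≤ n := n.cast_nonneg
    nlinarith
  nlinarith [sq_nonneg t]

/-- Termwise integration is allowed since the terms are nonnegative on the half-line and their
integrals are summable. -/
theorem integral_Ioi_one_sub_cos_mul_densS (t : ℝ) :
    HasSum (fun n : ℕ => t ^ 2 / (t ^ 2 + (Real.pi * (n + 1)) ^ 2))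
      (∫ x in Set.Ioi 0, (1 - Real.cos (t * x)) * densS x) := by
  have ha : ∀ n : ℕ, 0 < Real.pi * ((n : ℝ) + 1) := fun n => by positivity
  have h := hasSum_integral_of_summable_integral_norm (μ := volume.restrict (Set.Ioi 0))
    (F := fun (n : ℕ) x => (1 - Real.cos (t * x)) *
      (Real.pi * (n + 1) * Real.exp (-(Real.pi * (n + 1)) * x)))
    (fun n => integrableOn_one_sub_cos_mul_exp (ha n) t) (by
      refine (summable_div_sq_add t).congr fun n => ?_
      rw [← integral_one_sub_cos_mul_exp (ha n) t]
      congr 1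
      ext x
      rw [Real.norm_of_nonneg (one_sub_cos_mul_exp_nonneg (ha n) t x)])
  convert! h using 1
  · ext n
    exact (integral_one_sub_cos_mul_exp (ha n) t).symm
  · refine setIntegral_congr_fun measurableSet_Ioi fun x hx => ?_
    exact ((hasSum_densS hx).mul_left _).tsum_eq.symm

/-- This is the partial fraction expansion of the cotangent at `z = it/π`, multiplied by `z`: there
`πz cot(πz) = t coth t` and `π²z² = -t²`. -/
theorem mulCoth_sub_one_eq_tsum (t : ℝ) :
    mulCoth t - 1 = ∑' n : ℕ, 2 * (t ^ 2 / (t ^ 2 + (Real.pi * (n + 1)) ^ 2)) := by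
  rcases eq_or_ne t 0 with rfl | ht
  · simp [mulCoth]
  have hpi : (Real.pi : ℂ) ≠ 0 := by exact_mod_cast Real.pi_ne_zero
  have htc : (t : ℂ) ≠ 0 := by exact_mod_cast ht
  set z : ℂ := t * Complex.I / Real.pi with hz
  have hzim : z.im = t / Real.pi := by
    rw [hz, mul_div_right_comm, ← Complex.ofReal_div]
    simp
  have hmem : z ∈ Complex.integerComplement := by
    rintro ⟨n, hn⟩
    have := congrArg Complex.im hn
    rw [hzim] at this
    simp only [Complex.intCast_im] at this
    exact (div_ne_zero ht Real.pi_ne_zero) this.symm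
  have hz0 : z ≠ 0 := Complex.integerComplement.ne_zero hmem
  have hs : Complex.sinh t ≠ 0 := by
    rw [← Complex.ofReal_sinh]
    exact_mod_cast mt Real.sinh_eq_zero.1 ht
  have key := congrArg (fun w => z * w) (cot_series_rep' hmem)
  rw [← tsum_mul_left] at key
  have hl : z * (Real.pi * Complex.cot (Real.pi * z) - 1 / z) = ((mulCoth t - 1 : ℝ) : ℂ) := by
    have e : (Real.pi : ℂ) * z = t * Complex.I := by
      rw [hz]
      field_simp
    rw [e, Complex.cot, Complex.cos_mul_I, Complex.sin_mul_I, mulCoth, if_neg ht, mul_sub,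
      mul_one_div_cancel hz0, hz]
    push_cast
    field_simp
  have hr : ∀ n : ℕ, z * (1 / (z - (n + 1)) + 1 / (z + (n + 1))) =
      ((2 * (t ^ 2 / (t ^ 2 + (Real.pi * (n + 1)) ^ 2)) : ℝ) : ℂ) := by
    intro n
    have h1 : z - (n + 1) ≠ 0 := by
      intro h0
      refine hmem ⟨n + 1, ?_⟩
      push_cast
      linear_combination -h0
    have h2 : z + (n + 1) ≠ 0 := by
      intro h0
      refine hmem ⟨-(n + 1), ?_⟩
      push_cast
      linear_combination -h0
    have h3 : (t : ℂ) ^ 2 + (Real.pi * (n + 1)) ^ 2 ≠ 0 := by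
      have : t ^ 2 + (Real.pi * (n + 1)) ^ 2 ≠ 0 := by positivity
      exact_mod_cast this
    have hz2 : z ^ 2 * Real.pi ^ 2 = -(t : ℂ) ^ 2 := by
      rw [hz, div_pow, mul_pow, Complex.I_sq]
      field_simp
    push_cast
    rw [div_add_div _ _ h1 h2, ← mul_div_assoc, ← mul_div_assoc, div_eq_div_iff (mul_ne_zero h1 h2) h3]
    linear_combination 2 * ((n : ℂ) + 1) ^ 2 * hz2
  rw [hl, tsum_congr hr, ← Complex.ofReal_tsum] at key
  exact_mod_cast key

theorem integral_one_sub_cos_mul_densS (t : ℝ) :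
    ∫ x, (1 - Real.cos (t * x)) * densS x = mulCoth t - 1 := by
  have h1 : ∀ x, (1 - Real.cos (t * |x|)) * densS |x| = (1 - Real.cos (t * x)) * densS x := by
    intro x
    rcases abs_choice x with h | h <;> rw [h]
    rw [isLevyDensity_densS.even, mul_neg, Real.cos_neg]
  have h2 := integral_comp_abs (f := fun x => (1 - Real.cos (t * x)) * densS x)
  simp only [h1] at h2
  rw [h2, mulCoth_sub_one_eq_tsum, tsum_mul_left, (integral_Ioi_one_sub_cos_mul_densS t).tsum_eq]

/-! ### The densities of `N_C` and `N_T` -/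

/-- The counterpart of `mulCoth_two_mul_sub`: halving `x` in the density doubles `t` in the
exponent. All results for `N_C` are thereby reduced to `N_S`. At `x = 0` both sides are `0` by the
convention on division. -/
theorem densC_eq (x : ℝ) : densC x = densS (x / 2) / 2 - densS x := by
  rcases eq_or_ne x 0 with rfl | hx
  · simp [densC, densS]
  have hy : Real.pi * (x / 2) / 2 ≠ 0 := by
    have := Real.pi_ne_zero
    positivity
  have e : Real.pi * x / 2 = 2 * (Real.pi * (x / 2) / 2) := by ring
  have hs := mt Real.sinh_eq_zero.1 hy
  have hc := (Real.cosh_pos (Real.pi * (x / 2) / 2)).ne'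
  rw [densC, densS, densS, e, Real.sinh_two_mul, Real.cosh_two_mul]
  field_simp
  rw [Real.cosh_sq]
  ring

/-- Duplication formulas at `πx/4`. At `x = 0` this fails: `densC` and `densS` are `0` there by
convention, but `densT 0 = π/8`. -/
theorem densC_eq_densS_add_densT {x : ℝ} (hx : x ≠ 0) : densC x = densS x + densT x := by
  have hy : Real.pi * x / 4 ≠ 0 := by
    have := Real.pi_ne_zero
    positivity
  have e : Real.pi * x / 2 = 2 * (Real.pi * x / 4) := by ring
  have hs := mt Real.sinh_eq_zero.1 hy
  have hc := (Real.cosh_pos (Real.pi * x / 4)).ne'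
  rw [densC, densS, densT, e, Real.sinh_two_mul, Real.cosh_two_mul]
  field_simp
  rw [Real.cosh_sq]
  ring

theorem isLevyDensity_densC : IsLevyDensity densC where
  measurable := by unfold densC; fun_prop
  nonneg x := by
    have := Real.cosh_pos (Real.pi * x / 2)
    unfold densC
    positivity
  even x := by
    rw [densC, densC, mul_neg, neg_div, Real.sinh_neg, Real.cosh_neg, neg_sq]
  integrable := by
    have h := isLevyDensity_densS.integrable
    have h2 := ((h.comp_div (two_ne_zero (α := ℝ))).const_mul 2).sub h
    refine h2.congr (ae_of_all _ fun x => ?_)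
    simp only [Pi.sub_apply]
    rw [densC_eq]
    ring

theorem densT_le (x : ℝ) : densT x ≤ Real.pi / 8 * (1 + (Real.pi / 4 * x) ^ 2)⁻¹ := by
  rw [densT, one_div]
  refine mul_le_mul_of_nonneg_left (inv_anti₀ (by positivity) ?_) (by positivity)
  rw [← mul_div_right_comm]
  exact one_add_sq_le_cosh_sq _

theorem densT_nonneg (x : ℝ) : 0 ≤ densT x := by
  unfold densT
  positivity

theorem integrable_densT : Integrable densT := by
  have hpi : Real.pi / 4 ≠ 0 := by have := Real.pi_ne_zero; positivity
  refine ((integrable_inv_one_add_sq.comp_mul_left' hpi).const_mul (Real.pi / 8)).mono'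
    (Measurable.aestronglyMeasurable (by unfold densT; fun_prop)) (ae_of_all _ fun x => ?_)
  rw [Real.norm_of_nonneg (densT_nonneg x)]
  exact densT_le x

theorem isLevyDensity_densT : IsLevyDensity densT where
  measurable := by unfold densT; fun_prop
  nonneg := densT_nonneg
  even x := by
    rw [densT, densT, mul_neg, neg_div, Real.cosh_neg]
  integrable := by
    refine (isLevyDensity_densC.integrable.sub isLevyDensity_densS.integrable).congr
      (ae_of_all _ fun x => ?_)
    rcases eq_or_ne x 0 with rfl | hx
    · simp
    · simp only [Pi.sub_apply]
      rw [densC_eq_densS_add_densT hx]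
      ring

theorem measureOfDensity_densC :
    measureOfDensity densC = measureOfDensity densS + measureOfDensity densT := by
  have hm := isLevyDensity_densS.measurable
  rw [measureOfDensity, measureOfDensity, measureOfDensity, ← withDensity_add_left (by fun_prop)]
  refine withDensity_congr_ae ?_
  filter_upwards [compl_mem_ae_iff.2 (measure_singleton (0 : ℝ))] with x hx
  rw [Pi.add_apply, ← ENNReal.ofReal_add (isLevyDensity_densS.nonneg x) (densT_nonneg x),
    densC_eq_densS_add_densT hx]

theorem mulCoth_two_mul_sub (t : ℝ) : mulCoth (2 * t) - mulCoth t = t * Real.tanh t := by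
  rcases eq_or_ne t 0 with rfl | ht
  · simp [mulCoth]
  have hs := mt Real.sinh_eq_zero.1 ht
  have hc := (Real.cosh_pos t).ne'
  rw [mulCoth, mulCoth, if_neg ht, if_neg (by positivity), Real.tanh_eq_sinh_div_cosh,
    Real.sinh_two_mul, Real.cosh_two_mul]
  field_simp
  ring

/-- Over the common denominator `sinh t cosh t` this is `cosh² - sinh² = 1`. It yields the
factorization of `ψ_C`, the integral for `N_T` and the derivative of `log φ_T`. -/
theorem tanh_sub_coth (t : ℝ) : t * Real.tanh t - (mulCoth t - 1) = 1 - divSinh (2 * t) := by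
  rcases eq_or_ne t 0 with rfl | ht
  · simp [mulCoth, divSinh]
  have hs := mt Real.sinh_eq_zero.1 ht
  have hc := (Real.cosh_pos t).ne'
  rw [mulCoth, divSinh, if_neg ht, if_neg (by positivity), Real.tanh_eq_sinh_div_cosh,
    Real.sinh_two_mul]
  field_simp
  linear_combination -t * Real.cosh_sq t

theorem divSinh_two_mul (t : ℝ) : divSinh (2 * t) = 1 / Real.cosh t * divSinh t := by
  rcases eq_or_ne t 0 with rfl | ht
  · simp [divSinh]
  have hs := mt Real.sinh_eq_zero.1 ht
  have hc := (Real.cosh_pos t).ne'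
  rw [divSinh, divSinh, if_neg ht, if_neg (by positivity), Real.sinh_two_mul]
  field_simp

theorem integral_one_sub_cos_mul_densC (t : ℝ) :
    ∫ x, (1 - Real.cos (t * x)) * densC x = t * Real.tanh t := by
  have h1 := isLevyDensity_densS.integrable_one_sub_cos (2 * t)
  have e : ∀ x, (1 - Real.cos (t * x)) * densC x =
      (1 - Real.cos (2 * t * (x / 2))) * densS (x / 2) / 2 -
        (1 - Real.cos (t * x)) * densS x := by
    intro x
    rw [densC_eq, show 2 * t * (x / 2) = t * x by ring]
    ring
  simp_rw [e]
  rw [integral_sub ((h1.comp_div two_ne_zero).div_const 2)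
      (isLevyDensity_densS.integrable_one_sub_cos t), integral_div,
    Measure.integral_comp_div (fun x => (1 - Real.cos (2 * t * x)) * densS x),
    integral_one_sub_cos_mul_densS, integral_one_sub_cos_mul_densS, ← mulCoth_two_mul_sub,
    smul_eq_mul, abs_two]
  ring

theorem integral_one_sub_cos_mul_densT (t : ℝ) :
    ∫ x, (1 - Real.cos (t * x)) * densT x = 1 - divSinh (2 * t) := by
  rw [← tanh_sub_coth, ← integral_one_sub_cos_mul_densC, ← integral_one_sub_cos_mul_densS,
    ← integral_sub (isLevyDensity_densC.integrable_one_sub_cos t)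
      (isLevyDensity_densS.integrable_one_sub_cos t)]
  congr 1
  ext x
  rcases eq_or_ne x 0 with rfl | hx
  · simp
  · rw [densC_eq_densS_add_densT hx]
    ring

/-- `densT` is a logistic density, with primitive `-1/(e^{πx/2} + 1)`. Because the mass is exactly
`1`, the cosine integral is `1` minus the integral of `1 - cos`. -/
theorem integral_densT : ∫ x, densT x = 1 := by
  have hd : ∀ x, HasDerivAt (fun x => -(Real.exp (Real.pi / 2 * x) + 1)⁻¹) (densT x) x := by
    intro x
    have h1 : HasDerivAt (fun x => Real.exp (Real.pi / 2 * x) + 1)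
        (Real.exp (Real.pi / 2 * x) * (Real.pi / 2)) x := by
      simpa using (((hasDerivAt_id x).const_mul (Real.pi / 2)).exp).add_const 1
    have hpos : Real.exp (Real.pi / 2 * x) + 1 ≠ 0 := by positivity
    convert! (h1.inv hpos).neg using 1
    have e : Real.exp (Real.pi / 2 * x) = Real.exp (Real.pi * x / 4) ^ 2 := by
      rw [← Real.exp_nat_mul]
      congr 1
      push_cast
      ring
    rw [e] at hpos
    rw [densT, Real.cosh_eq, Real.exp_neg, e]
    have hp := Real.exp_pos (Real.pi * x / 4)
    set p := Real.exp (Real.pi * x / 4)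
    have e1 : (p + p⁻¹) / 2 = (p ^ 2 + 1) / (2 * p) := by field_simp
    rw [e1]
    field_simp
    norm_num
  have hpi : 0 < Real.pi / 2 := by positivity
  have hbot : Tendsto (fun x => -(Real.exp (Real.pi / 2 * x) + 1)⁻¹) atBot (𝓝 (-1)) := by
    have h1 := (Real.tendsto_exp_atBot.comp (tendsto_id.const_mul_atBot hpi)).add_const 1
    simpa only [zero_add, inv_one, Function.comp_apply, id] using (h1.inv₀ (by norm_num)).neg
  have htop : Tendsto (fun x => -(Real.exp (Real.pi / 2 * x) + 1)⁻¹) atTop (𝓝 0) := by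
    have h1 := tendsto_atTop_add_const_right _ 1
      (Real.tendsto_exp_atTop.comp (tendsto_id.const_mul_atTop hpi))
    simpa using (tendsto_inv_atTop_zero.comp h1).neg
  rw [integral_of_hasDerivAt_of_tendsto hd integrable_densT hbot htop]
  norm_num

theorem integrable_cos_mul_densT (t : ℝ) : Integrable fun x => Real.cos (t * x) * densT x := by
  refine integrable_densT.bdd_mul (c := 1) (Measurable.aestronglyMeasurable (by fun_prop))
    (ae_of_all _ fun x => ?_)
  exact Real.abs_cos_le_one _

theorem integral_cos_mul_densT (t : ℝ) :
    ∫ x, Real.cos (t * x) * densT x = divSinh (2 * t) := by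
  have h : ∫ x, (1 - Real.cos (t * x)) * densT x =
      ∫ x, densT x - Real.cos (t * x) * densT x := by
    congr 1
    ext x
    ring
  rw [integral_one_sub_cos_mul_densT, integral_sub integrable_densT (integrable_cos_mul_densT t),
    integral_densT] at h
  linarith

/-! ### The hyperbolic characteristic functions -/

theorem tendsto_sinh_div_self : Tendsto (fun t => Real.sinh t / t) (𝓝[≠] 0) (𝓝 1) := by
  have h := (Real.hasDerivAt_sinh 0).tendsto_slope_zero
  simpa [div_eq_inv_mul] using h

theorem sinh_div_self_pos {t : ℝ} (ht : t ≠ 0) : 0 < Real.sinh t / t := by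
  rcases ht.lt_or_gt with h | h
  · exact div_pos_of_neg_of_neg (Real.sinh_neg_iff.2 h) h
  · exact div_pos (Real.sinh_pos_iff.2 h) h

theorem divSinh_pos (t : ℝ) : 0 < divSinh t := by
  rcases eq_or_ne t 0 with rfl | ht
  · simp [divSinh]
  · rw [divSinh, if_neg ht, ← inv_div]
    exact inv_pos.2 (sinh_div_self_pos ht)

theorem divSinh_zero : divSinh 0 = 1 := if_pos rfl

theorem continuousAt_divSinh : ContinuousAt divSinh 0 := by
  rw [continuousAt_iff_punctured_nhds, divSinh_zero]
  have h := tendsto_sinh_div_self.inv₀ one_ne_zero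
  rw [inv_one] at h
  refine h.congr' ?_
  filter_upwards [self_mem_nhdsWithin] with t ht
  rw [divSinh, if_neg (show t ≠ 0 from ht), inv_div]

theorem phiC_pos (t : ℝ) : 0 < phiC t := one_div_pos.2 (Real.cosh_pos t)

/-- This is `φ_C = φ_S φ_T`: the logarithmic derivative of `φ_T` becomes a difference of the other
two. -/
theorem phiT_eq (t : ℝ) : phiT t = phiC t / divSinh t := by
  rcases eq_or_ne t 0 with rfl | ht
  · simp [phiT, phiC, divSinh]
  · rw [phiT, phiC, divSinh, if_neg ht, if_neg ht, Real.tanh_eq_sinh_div_cosh]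
    field_simp

theorem phiT_pos (t : ℝ) : 0 < phiT t := by
  rw [phiT_eq]
  exact div_pos (phiC_pos t) (divSinh_pos t)

theorem continuousAt_phiC : ContinuousAt phiC 0 := by
  unfold phiC
  exact (continuous_const.div Real.continuous_cosh fun t => (Real.cosh_pos t).ne').continuousAt

theorem continuousAt_phiT : ContinuousAt phiT 0 := by
  rw [show phiT = fun t => phiC t / divSinh t from funext phiT_eq]
  exact continuousAt_phiC.div continuousAt_divSinh (divSinh_pos 0).ne'

theorem hasDerivAt_log_phiC {t : ℝ} (ht : t ≠ 0) :
    HasDerivAt (fun s => Real.log (phiC s)) (-(t * Real.tanh t) / t) t := by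
  have h := ((Real.hasDerivAt_cosh t).log (Real.cosh_pos t).ne').neg
  convert! h using 1
  · ext s
    simp [phiC, Real.log_inv]
  · rw [Real.tanh_eq_sinh_div_cosh]
    field_simp

theorem hasDerivAt_log_phiS {t : ℝ} (ht : t ≠ 0) :
    HasDerivAt (fun s => Real.log (phiS s)) ((1 - mulCoth t) / t) t := by
  have hs := mt Real.sinh_eq_zero.1 ht
  have h := (Real.hasDerivAt_log ht).sub ((Real.hasDerivAt_sinh t).log hs)
  -- `Real.log` is `log |·|`, so the splitting holds for negative `s` as well.
  have heq : (fun s => Real.log (phiS s)) =ᶠ[𝓝 t] fun s => Real.log s - Real.log (Real.sinh s) := by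
    filter_upwards [eventually_ne_nhds ht] with s hs'
    rw [phiS, divSinh, if_neg hs', Real.log_div hs' (mt Real.sinh_eq_zero.1 hs')]
  convert! h.congr_of_eventuallyEq heq using 1
  rw [mulCoth, if_neg ht]
  field_simp

theorem hasDerivAt_log_phiT {t : ℝ} (ht : t ≠ 0) :
    HasDerivAt (fun s => Real.log (phiT s)) ((divSinh (2 * t) - 1) / t) t := by
  have h := (hasDerivAt_log_phiC ht).sub (hasDerivAt_log_phiS ht)
  convert! h using 1
  · ext s
    rw [phiT_eq, Real.log_div (phiC_pos s).ne' (divSinh_pos s).ne']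
    rfl
  · rw [← sub_div]
    congr 1
    linarith [tanh_sub_coth t]

theorem isDrivingExponent_phiC : IsDrivingExponent (fun t => -(t * Real.tanh t))
    (fun t => Real.log (phiC t)) (∫ x, x ^ 2 * densC x) :=
  isLevyDensity_densC.isDrivingExponent (fun t => by rw [integral_one_sub_cos_mul_densC])
    (by simp [phiC]) continuousAt_phiC fun _ => hasDerivAt_log_phiC

theorem isDrivingExponent_phiS : IsDrivingExponent (fun t => 1 - mulCoth t)
    (fun t => Real.log (phiS t)) (∫ x, x ^ 2 * densS x) :=
  isLevyDensity_densS.isDrivingExponent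
    (fun t => by rw [integral_one_sub_cos_mul_densS, neg_sub])
    divSinh_zero continuousAt_divSinh fun _ => hasDerivAt_log_phiS

theorem isDrivingExponent_phiT : IsDrivingExponent (fun t => divSinh (2 * t) - 1)
    (fun t => Real.log (phiT t)) (∫ x, x ^ 2 * densT x) :=
  isLevyDensity_densT.isDrivingExponent
    (fun t => by rw [integral_one_sub_cos_mul_densT, neg_sub])
    (if_pos rfl) continuousAt_phiT fun _ => hasDerivAt_log_phiT

theorem ofReal_eq_exp_log {φ : ℝ → ℝ} (hφ : ∀ t, 0 < φ t) :
    (fun t => (φ t : ℂ)) = fun t => Complex.exp (Real.log (φ t) : ℂ) := by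
  ext t
  rw [← Complex.ofReal_exp, Real.exp_log (hφ t)]

theorem psiC_eq_psiS_mul_psiT (t : ℝ) : psiC t = psiS t * psiT t := by
  rw [psiC, psiS, psiT, ← Real.exp_add]
  congr 1
  linarith [tanh_sub_coth t]

theorem psiT_eq (t : ℝ) : psiT t = Real.exp (1 / Real.cosh t * divSinh t - 1) := by
  rw [psiT, divSinh_two_mul]

end HyperbolicSD

end

/-! ### The main theorem. -/

open HyperbolicSD in
theorem corollary1 :
    -- the three hyperbolic characteristic functions are selfdecomposable
    (IsSelfdecomposable (fun t => (phiC t : ℂ)) ∧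
      IsSelfdecomposable (fun t => (phiS t : ℂ)) ∧
      IsSelfdecomposable (fun t => (phiT t : ℂ))) ∧
    -- their background driving characteristic functions
    (IsBackgroundDrivingCharFun (fun t => (psiC t : ℂ)) (fun t => (phiC t : ℂ)) ∧
      IsBackgroundDrivingCharFun (fun t => (psiS t : ℂ)) (fun t => (phiS t : ℂ)) ∧
      IsBackgroundDrivingCharFun (fun t => (psiT t : ℂ)) (fun t => (phiT t : ℂ))) ∧
    -- the relation `ψ(t) = exp (t (log φ)'(t))` for `t ≠ 0`
    (∀ t : ℝ, t ≠ 0 →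
      (∃ d : ℝ, HasDerivAt (fun s => Real.log (phiC s)) d t ∧ psiC t = Real.exp (t * d)) ∧
      (∃ d : ℝ, HasDerivAt (fun s => Real.log (phiS s)) d t ∧ psiS t = Real.exp (t * d)) ∧
      (∃ d : ℝ, HasDerivAt (fun s => Real.log (phiT s)) d t ∧ psiT t = Real.exp (t * d))) ∧
    -- factorization and the two forms of `ψ_T`
    (∀ t : ℝ, psiC t = psiS t * psiT t) ∧
    (∀ t : ℝ, psiT t = Real.exp (1 / Real.cosh t * divSinh t - 1)) ∧
    (∀ t : ℝ, Real.exp (-(t * Real.tanh t)) =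
      Real.exp (1 - mulCoth t) * Real.exp (1 / Real.cosh t * divSinh t - 1)) ∧
    -- infinite divisibility and finite logarithmic moments
    (∀ ψ ∈ ({psiC, psiS, psiT} : Set (ℝ → ℝ)),
      IsInfinitelyDivisible (fun t => (ψ t : ℂ)) ∧
      ∃ μ : Measure ℝ, HasCharFun μ (fun t => (ψ t : ℂ)) ∧ HasFiniteLogMoment μ) ∧
    -- the Lévy measures
    (IsLevyMeasureOf (measureOfDensity densC) (fun t => (psiC t : ℂ)) ∧
      IsLevyMeasureOf (measureOfDensity densS) (fun t => (psiS t : ℂ)) ∧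
      IsLevyMeasureOf (measureOfDensity densT) (fun t => (psiT t : ℂ)) ∧
      measureOfDensity densC = measureOfDensity densS + measureOfDensity densT) ∧
    -- the Fourier integral identities
    (∀ t : ℝ,
      (IntegrableOn (fun x : ℝ => (1 - Real.cos (t * x)) * densC x) {0}ᶜ ∧
        ∫ x in ({0}ᶜ : Set ℝ), (1 - Real.cos (t * x)) * densC x = t * Real.tanh t) ∧
      (IntegrableOn (fun x : ℝ => (1 - Real.cos (t * x)) * densS x) {0}ᶜ ∧
        ∫ x in ({0}ᶜ : Set ℝ), (1 - Real.cos (t * x)) * densS x = mulCoth t - 1) ∧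
      (IntegrableOn (fun x : ℝ => (1 - Real.cos (t * x)) * densT x) {0}ᶜ ∧
        ∫ x in ({0}ᶜ : Set ℝ), (1 - Real.cos (t * x)) * densT x = 1 - divSinh (2 * t)) ∧
      (IntegrableOn (fun x : ℝ => Real.cos (t * x) * densT x) {0}ᶜ ∧
        ∫ x in ({0}ᶜ : Set ℝ), Real.cos (t * x) * densT x = divSinh (2 * t))) := by
  have hC : (fun t => (psiC t : ℂ)) = fun t => Complex.exp ((-(t * Real.tanh t) : ℝ) : ℂ) :=
    funext fun t => Complex.ofReal_exp _
  have hS : (fun t => (psiS t : ℂ)) = fun t => Complex.exp ((1 - mulCoth t : ℝ) : ℂ) :=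
    funext fun t => Complex.ofReal_exp _
  have hT : (fun t => (psiT t : ℂ)) = fun t => Complex.exp ((divSinh (2 * t) - 1 : ℝ) : ℂ) :=
    funext fun t => Complex.ofReal_exp _
  have hexp : ∀ {t : ℝ} (g : ℝ), t ≠ 0 → Real.exp g = Real.exp (t * (g / t)) := fun g ht => by
    rw [mul_div_cancel₀ g ht]
  refine ⟨⟨?_, ?_, ?_⟩, ⟨?_, ?_, ?_⟩, fun t ht => ⟨⟨_, hasDerivAt_log_phiC ht, hexp _ ht⟩,
    ⟨_, hasDerivAt_log_phiS ht, hexp _ ht⟩, ⟨_, hasDerivAt_log_phiT ht, hexp _ ht⟩⟩,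
    psiC_eq_psiS_mul_psiT, psiT_eq, fun t => ?_, ?_, ⟨?_, ?_, ?_, measureOfDensity_densC⟩,
    fun t => ?_⟩
  · rw [ofReal_eq_exp_log phiC_pos]
    exact isDrivingExponent_phiC.isSelfdecomposable
  · rw [ofReal_eq_exp_log (φ := phiS) divSinh_pos]
    exact isDrivingExponent_phiS.isSelfdecomposable
  · rw [ofReal_eq_exp_log phiT_pos]
    exact isDrivingExponent_phiT.isSelfdecomposable
  · rw [ofReal_eq_exp_log phiC_pos, hC]
    exact isDrivingExponent_phiC.isBackgroundDrivingCharFun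
  · rw [ofReal_eq_exp_log (φ := phiS) divSinh_pos, hS]
    exact isDrivingExponent_phiS.isBackgroundDrivingCharFun
  · rw [ofReal_eq_exp_log phiT_pos, hT]
    exact isDrivingExponent_phiT.isBackgroundDrivingCharFun
  · rw [← psiT_eq]
    exact psiC_eq_psiS_mul_psiT t
  · rintro ψ (rfl | rfl | rfl)
    · rw [hC]
      exact ⟨isDrivingExponent_phiC.isInfinitelyDivisible,
        isDrivingExponent_phiC.exists_hasFiniteLogMoment⟩
    · rw [hS]
      exact ⟨isDrivingExponent_phiS.isInfinitelyDivisible,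
        isDrivingExponent_phiS.exists_hasFiniteLogMoment⟩
    · rw [hT]
      exact ⟨isDrivingExponent_phiT.isInfinitelyDivisible,
        isDrivingExponent_phiT.exists_hasFiniteLogMoment⟩
  · refine isLevyDensity_densC.isLevyMeasureOf fun t => ?_
    rw [integral_one_sub_cos_mul_densC]
    exact congrFun hC t
  · refine isLevyDensity_densS.isLevyMeasureOf fun t => ?_
    rw [integral_one_sub_cos_mul_densS, neg_sub]
    exact congrFun hS t
  · refine isLevyDensity_densT.isLevyMeasureOf fun t => ?_
    rw [integral_one_sub_cos_mul_densT, neg_sub]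
    exact congrFun hT t
  -- The origin is a null set, so these are integrals over the whole line.
  · rw [restrict_compl_singleton]
    exact ⟨⟨(isLevyDensity_densC.integrable_one_sub_cos t).integrableOn,
        integral_one_sub_cos_mul_densC t⟩,
      ⟨(isLevyDensity_densS.integrable_one_sub_cos t).integrableOn,
        integral_one_sub_cos_mul_densS t⟩,
      ⟨(isLevyDensity_densT.integrable_one_sub_cos t).integrableOn,
        integral_one_sub_cos_mul_densT t⟩,
      ⟨(integrable_cos_mul_densT t).integrableOn, integral_cos_mul_densT t⟩⟩
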